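/- **Setting.** Let $\mathbf A$ be a finite alphabet. For parameters $k_0\in\mathbb N$, $0<\alpha<1$, $\beta>1$, $0<\delta<1$, $R>0$ and integers $1\le\ell\le n_0$, let $M=M_{k_0,\alpha,\beta,\delta,R,\ell,n_0}$ be the set of stationary ergodic probability measures $P$ on doubly infinite sequences $(X_i)_{i\in\mathbb Z}$ over $\mathbf A$ such that * (A) for every letter $a$, $P(X_1=a\mid X_i,\ i\ne 1)\ge\delta$ almost surely; * (B) for all $k\ge k_0$, $E\in\sigma(X_i:i\le 0)$, $F\in\sigma(X_i:i\ge k)$ with $P(E),P(F)>0$: $\ \frac1\beta\le \frac{P(F)}{P(F\mid E)}\le\beta$; * (C) $P\{P(X_1^\ell)\le 2^{-\ell R}\}\le\alpha$, and $P\{P(X_1^n)\le 2^{-nR}\}\le\frac1n$ for every $n\ge n_0$. Logarithms are to base 2. Fix $\varepsilon_0>0$, and put $N_0=2^{R\ell}$ and $L_{\max,n}=\lfloor\log n/(R+\varepsilon_0)\rfloor$. **VL-divergence.** Let $L_n(x\mid Q)$ be the largest $1\le j\le L_{\max,n}$ with $Q(x_1^{j-1})\ge \frac1n$ (the first $j$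 with $Q(x_1^{j})<\frac1n$, capped at $L_{\max,n}$; the empty word has probability 1). Let $L_n(P|Q)=E_P L_n(X\mid Q)$ and $$D_{VL,n}(P\|Q)=\frac{\log n}{L_n(P|Q)}-\frac{\log n}{L_n(P|P)} .$$ **Classifier.** Let $K\ge1$ and $\bar N=K(N+k_0)+N$. Given independent $\mathbf X=X_1^{\bar N}$ with law $P$ and $\mathbf Y=Y_1^{\bar N}$ with law $Q$, let $\mathbf X'$ consist of the $K$ blocks $X_{b(N+k_0)+1}^{b(N+k_0)+N}$, $0\le b<K$, define $\mathbf Y'$ likewise, and let $Z_1^N=X_{K(N+k_0)+1}^{\bar N}$. For a word $z$, let $\hat N(z|\mathbf Y')$ be the smallest $k\ge 1$ such that $z$ occurs at position $k$ inside one of the blocks of $\mathbf Y'$ ($\infty$ if there is none). Let $L_{i,N,K}(\mathbf X|\mathbf Y)$ be the largest $1\le j\le L_{\max,N}$ for which $Z_i^{i+j-2}$ lies inside $Z_1^N$ and $\hat N(Z_i^{i+j-2}|\mathbf Y')\le N$, and let $L_{i,N,K}(\mathbf X)$ be the same with $\mathbf X'$ in place of $\mathbf Y'$. Put $$d_{VL,N}(\mathbf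 X,\mathbf Y)=\frac{\log N}{\frac1N\sum_{i=1}^N L_{i,N,K}(\mathbf X|\mathbf Y)}-\frac{\log N}{\frac1N\sum_{i=1}^N L_{i,N,K}(\mathbf X)},$$ and let $f_{c,VL}(\mathbf X,\mathbf Y)=1$ if $d_{VL,N}(\mathbf X,\mathbf Y)\ge\Delta/2$, and $0$ otherwise. Its classification error is $$\lambda_{VL,N,\bar N,f_{c,VL},\Delta}=\sup_{P,Q\in M}\Pr\bigl[(f_{c,VL}=1\text{ and }P_N=Q_N)\ \text{ or }\ (D_{VL,N}(P\|Q)\ge\Delta\text{ and }f_{c,VL}=0)\bigr],$$ where $P_N$ denotes the $N$-th order marginal of $P$. **Theorem.** Fix $\mathbf A$, $k_0$, $K$, $\delta$, $R$ and $\varepsilon_0$. 1. (Asymptotic optimality.) For all $\alpha,\beta,\ell,n_0$ as above and every $\varepsilon>0$, $$\sup_{P,Q\in M}\Pr\bigl[\,|d_{VL,N}(\mathbf X,\mathbf Y)-D_{VL,N}(P\|Q)|\ge\varepsilon\,\bigr]\longrightarrow0\qquad(N\to\infty),$$ and $\lambda_{VL,N,\bar N,f_{c,VL},\Delta}\to0$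 as $N\to\infty$, for every $\Delta>0$. 2. (Optimality relative to the VL-divergence.) For every $\Delta_0>0$ there are $\beta_0>1$ and $\alpha_0>0$ such that for every $\eta>0$ there is $\ell_0$ with the following property: if $\ell\ge\ell_0$, $n_0\ge\ell$, $0<\alpha\le\alpha_0$, $\alpha<1$ and $1<\beta\le\beta_0$, then $\lambda_{VL,N,\bar N,f_{c,VL},\Delta}\le\eta$ for every $\Delta\ge\Delta_0$ and every $N$ with $\bar N\ge N_02^{\varepsilon_0\ell}$. -/

import Mathlib

open MeasureTheory Filter Topology
open scoped ENNReal

namespace VLClassification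

noncomputable section

/-! ### The class of vanishing memory sources -/

/-- The left shift on doubly infinite sequences. -/
def shift {A : Type*} (x : ℤ → A) : ℤ → A := fun i => x (i + 1)

/-- The sigma-field generated by the coordinates `X_i`, `i ∈ S`. -/
abbrev coordSigma (A : Type*) [mA : MeasurableSpace A] (S : Set ℤ) : MeasurableSpace (ℤ → A) :=
  ⨆ i ∈ S, MeasurableSpace.comap (fun x : ℤ → A => x i) mA

/-- `wordProb P x n` is the probability `P(x_1^n)` that `P` gives to the first `n` letters
`x_1, …, x_n` of `x`; for `n = 0` it is the probability `1` of the empty word. -/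
def wordProb {A : Type*} [MeasurableSpace A] (P : Measure (ℤ → A)) (x : ℤ → A) (n : ℕ) : ℝ :=
  P.real {y | ∀ i : ℤ, 1 ≤ i → i ≤ n → y i = x i}

/-- `P` belongs to the class `M` with parameters `k₀, α, β, δ, R, ℓ, n₀`. -/
structure IsVanishingMemory {A : Type*} [MeasurableSpace A]
    (k₀ : ℕ) (α β δ R : ℝ) (ℓ n₀ : ℕ) (P : Measure (ℤ → A)) : Prop where
  isProb : IsProbabilityMeasure P
  /-- `P` is stationary and ergodic. -/
  ergodic : Ergodic shift P
  /-- Positive transitions: given all the other letters, every value of the letter `X_1` has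
  conditional probability at least `δ`. -/
  positive : ∀ a : A, ∀ᵐ x ∂P,
    δ ≤ condExp (coordSigma A {i | i ≠ 1}) P
      ({y : ℤ → A | y 1 = a}.indicator (fun _ => (1 : ℝ))) x
  /-- Strong mixing. -/
  mixing : ∀ k : ℕ, k₀ ≤ k → ∀ E F : Set (ℤ → A),
    MeasurableSet[coordSigma A {i | i ≤ 0}] E →
    MeasurableSet[coordSigma A {i | (k : ℤ) ≤ i}] F →
    0 < P.real E → 0 < P.real F →
    1 / β ≤ P.real F / (ProbabilityTheory.cond P E).real F ∧
      P.real F / (ProbabilityTheory.cond P E).real F ≤ β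
  /-- At length `ℓ`, words of probability at most `2 ^ (-ℓ R)` are rare. -/
  typical : P.real {x | wordProb P x ℓ ≤ (2 : ℝ) ^ (-((ℓ : ℝ) * R))} ≤ α
  /-- At every length `n ≥ n₀`, words of probability at most `2 ^ (-n R)` are rare. -/
  typical_large : ∀ n : ℕ, n₀ ≤ n →
    P.real {x | wordProb P x n ≤ (2 : ℝ) ^ (-((n : ℝ) * R))} ≤ 1 / (n : ℝ)

/-- The class `M` with parameters `k₀, α, β, δ, R, ℓ, n₀`. -/
def vanishingMemoryClass (A : Type*) [MeasurableSpace A]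
    (k₀ : ℕ) (α β δ R : ℝ) (ℓ n₀ : ℕ) : Set (Measure (ℤ → A)) :=
  {P | IsVanishingMemory k₀ α β δ R ℓ n₀ P}

/-! ### The variable length divergence -/

/-- The cap `L_{max,n} = log n / (R + ε₀)`, rounded down. -/
def Lmax (R ε₀ : ℝ) (n : ℕ) : ℕ := ⌊Real.logb 2 n / (R + ε₀)⌋₊

open Classical in
/-- `L_n(x | Q)`: the largest `j` with `1 ≤ j ≤ L_{max,n}` and `Q(x_1^{j-1}) ≥ 1/n`. Thus it is the
first `j` with `Q(x_1^j) < 1/n`, capped at `L_{max,n}`. -/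
def wordLength {A : Type*} [MeasurableSpace A] (R ε₀ : ℝ) (n : ℕ)
    (Q : Measure (ℤ → A)) (x : ℤ → A) : ℕ :=
  ((Finset.Icc 1 (Lmax R ε₀ n)).filter (fun j => 1 / (n : ℝ) ≤ wordProb Q x (j - 1))).sup id

/-- `L_n(P | Q) = E_P L_n(X | Q)`. -/
def meanLength {A : Type*} [MeasurableSpace A] (R ε₀ : ℝ) (n : ℕ)
    (P Q : Measure (ℤ → A)) : ℝ :=
  ∫ x, (wordLength R ε₀ n Q x : ℝ) ∂P

/-- The divergence `D_{VL,n}(P ‖ Q)`. -/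
def DVL {A : Type*} [MeasurableSpace A] (R ε₀ : ℝ) (n : ℕ) (P Q : Measure (ℤ → A)) : ℝ :=
  Real.logb 2 n / meanLength R ε₀ n P Q - Real.logb 2 n / meanLength R ε₀ n P P

/-! ### Classifiers and the classification error -/

/-- A classifier for pairs of sequences of length `m`; the value `1` declares the two sources
to be different. -/
abbrev Classifier (A : Type*) (m : ℕ) := (Fin m → A) → (Fin m → A) → Fin 2

/-- The segment `x_1, …, x_m` of `x`. -/
def segment {A : Type*} (m : ℕ) (x : ℤ → A) : Fin m → A := fun i => x ((i : ℤ) + 1)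

/-- The probability of error, for independent `X` with law `P` and `Y` with law `Q`: either the
marginals of order `n` agree and the classifier says `1`, or `D_{VL,n}(P ‖ Q) ≥ Δ` and the
classifier says `0`. -/
def errorProb {A : Type*} [MeasurableSpace A] (R ε₀ : ℝ) (n m : ℕ) (f : Classifier A m) (Δ : ℝ)
    (P Q : Measure (ℤ → A)) : ℝ≥0∞ :=
  (P.prod Q) {ω |
    (f (segment m ω.1) (segment m ω.2) = 1 ∧ P.map (segment n) = Q.map (segment n)) ∨
    (Δ ≤ DVL R ε₀ n P Q ∧ f (segment m ω.1) (segment m ω.2) = 0)}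

/-- The classification error of `f` over a class `M` of sources. -/
def classError {A : Type*} [MeasurableSpace A] (R ε₀ : ℝ) (n m : ℕ) (f : Classifier A m) (Δ : ℝ)
    (M : Set (Measure (ℤ → A))) : ℝ≥0∞ :=
  ⨆ P ∈ M, ⨆ Q ∈ M, errorProb R ε₀ n m f Δ P Q

/-! ### The classifier based on recurrence times -/

/-- The length `K (N + k₀) + N` of each of the two observed sequences. -/
def seqLength (K k₀ N : ℕ) : ℕ := K * (N + k₀) + N

/-- The training data of `y`: the `K` blocks of length `N` that start at the positions
`b (N + k₀) + 1`, `0 ≤ b < K`; consecutive blocks are separated by guard spaces of `k₀` letters. -/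
def trainingBlocks {A : Type*} (K k₀ N : ℕ) (y : Fin (seqLength K k₀ N) → A) : List (List A) :=
  (List.range K).map (fun b => ((List.ofFn y).drop (b * (N + k₀))).take N)

/-- The suffix `Z` of `x`, of length `N`, which follows the training data. -/
def suffix {A : Type*} (K k₀ N : ℕ) (x : Fin (seqLength K k₀ N) → A) : List A :=
  (List.ofFn x).drop (K * (N + k₀))

/-- The recurrence time of the word `z`: the smallest `k ≥ 1` such that `z` occurs in some block
beginning at the `k`-th letter of the block; it is infinite if `z` occurs in no block. -/
def recurrenceTime {A : Type*} (blocks : List (List A)) (z : List A) : ℕ∞ :=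
  sInf {t : ℕ∞ | ∃ k : ℕ, 1 ≤ k ∧ (∃ b ∈ blocks, z <+: b.drop (k - 1)) ∧ t = k}

open Classical in
/-- The largest `j` with `1 ≤ j ≤ L_{max,N}` such that the prefix of length `j - 1` of `w` exists
and has recurrence time at most `N`. Thus it is the first `j` for which the recurrence time of
the prefix of length `j` exceeds `N`, capped at `L_{max,N}` and by the end of `w`. -/
def matchLength {A : Type*} (R ε₀ : ℝ) (N : ℕ) (blocks : List (List A)) (w : List A) : ℕ :=
  ((Finset.Icc 1 (Lmax R ε₀ N)).filter
    (fun j => j - 1 ≤ w.length ∧ recurrenceTime blocks (w.take (j - 1)) ≤ (N : ℕ∞))).sup id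

/-- The average `(1/N) ∑_{i=1}^N L_{i,N,K}` of the match lengths of the `N` suffixes
`Z_i^N`, `1 ≤ i ≤ N`, of the word `Z`. -/
def meanMatchLength {A : Type*} (R ε₀ : ℝ) (N : ℕ) (blocks : List (List A)) (Z : List A) : ℝ :=
  (1 / (N : ℝ)) * ∑ i ∈ Finset.range N, (matchLength R ε₀ N blocks (Z.drop i) : ℝ)

/-- The statistic `d_{VL,N}(x, y)`. -/
def dVL {A : Type*} (R ε₀ : ℝ) (K k₀ N : ℕ) (x y : Fin (seqLength K k₀ N) → A) : ℝ :=
  Real.logb 2 N / meanMatchLength R ε₀ N (trainingBlocks K k₀ N y) (suffix K k₀ N x) -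
    Real.logb 2 N / meanMatchLength R ε₀ N (trainingBlocks K k₀ N x) (suffix K k₀ N x)

open Classical in
/-- The classifier that says `1` exactly if `d_{VL,N}(x, y) ≥ Δ / 2`. -/
def fVL (A : Type*) (R ε₀ : ℝ) (K k₀ N : ℕ) (Δ : ℝ) : Classifier A (seqLength K k₀ N) :=
  fun x y => if Δ / 2 ≤ dVL R ε₀ K k₀ N x y then 1 else 0

/-- The largest probability, over sources `P, Q` in `M`, that for independent `X` with law `P`
and `Y` with law `Q` the statistic `d_{VL,N}(X, Y)` is at distance at least `ε` from
`D_{VL,N}(P ‖ Q)`. -/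
def deviation {A : Type*} [MeasurableSpace A] (R ε₀ : ℝ) (K k₀ N : ℕ) (ε : ℝ)
    (M : Set (Measure (ℤ → A))) : ℝ≥0∞ :=
  ⨆ P ∈ M, ⨆ Q ∈ M, (P.prod Q) {ω |
    ε ≤ |dVL R ε₀ K k₀ N (segment (seqLength K k₀ N) ω.1) (segment (seqLength K k₀ N) ω.2)
      - DVL R ε₀ N P Q|}

end

end VLClassification

/-!
The theorem follows from uniform convergence in probability of the statistic `d_{VL,N}` to the
divergence `D_{VL,N}`, over all pairs of sources with a bounded mixing constant `β`. Indeed, a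
classification error of threshold `Δ` forces a deviation of at least `Δ / 2`
(`errorProb_le`), because the divergence is `0` when the marginals of order `N ≥ L_{max,N}` agree.
In the second part the lower bound for the length of the data makes `N` tend to infinity with `ℓ`,
so that any bound `β₀` will do, for example `β₀ = 2`.

Since words of length `n` have probability at least `δ ^ n`, all mean lengths are of order `log N`,
and the convergence reduces to showing that the mean match length differs from `L_N(P | Q)` by
`o(log N)`. This rests on three facts.

* Words of probability at least `N ^ (-1 + κ)` occur in the training data, except with small
  probability (`RatioMixing.measureReal_exists_not_occurs_le`), and the expected number of matches
  of words of probability less than `N ^ (-1 - κ)` is `o(N)`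
  (`RatioMixing.measureReal_rareMatch_le`). When training and test data belong to the same sequence,
  the guard space allows them to be treated as independent, at the cost of the factor `β`
  (`RatioMixing.measureReal_le_of_forall`).
* Over at least two letters, word probabilities decay exponentially, by positivity of the
  transitions, so that the lengths at which they fall below `N ^ (-1 + κ)` and `N ^ (-1 - κ)` differ by `O(κ log N)`
  (`RatioMixing.thresholdLength_le`).
* The averages of `L_N(· | Q)` along the test data concentrate, uniformly in the sources
  (`exists_concentration`). The constant `β` does not tend to `1` with the gap, so covariances
  cannot be bounded directly. But for a centred function `S` of the past and a shifted copy `S'` in the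
  future, the lower mixing bound makes `E (S - S')²` at least `1 / β` times its value for
  independent copies. Hence `(S + S') / 2` has mean square at most `(1 - 1 / (2 β)) E S²`, and iterating this
  over longer and longer averages gives the weak law with a rate depending on `β` only.
-/

namespace VLClassification

/-! ### Events depending on finitely many coordinates -/

section Coordinates

variable {A : Type*}

/-- The shift of a doubly infinite sequence by an arbitrary integer. -/
def shiftBy (a : ℤ) (x : ℤ → A) : ℤ → A := fun i => x (i + a)

/-- The cylinder of all sequences which agree with `x` at the positions `1, …, n`. -/
def cylinder (x : ℤ → A) (n : ℕ) : Set (ℤ → A) := {y | ∀ i : ℤ, 1 ≤ i → i ≤ n → y i = x i}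

lemma shiftBy_shiftBy (a b : ℤ) (x : ℤ → A) : shiftBy a (shiftBy b x) = shiftBy (a + b) x := by
  funext i; simp [shiftBy, add_assoc]

lemma shiftBy_zero (x : ℤ → A) : shiftBy 0 x = x := by
  funext i; simp [shiftBy]

lemma DependsOn.comp_shiftBy {γ : Type*} {f : (ℤ → A) → γ} {s t : Set ℤ} (hf : DependsOn f s)
    (a : ℤ) (hst : ∀ i ∈ s, i + a ∈ t) : DependsOn (fun x => f (shiftBy a x)) t :=
  fun _ _ h => hf fun i hi => h _ (hst i hi)

lemma dependsOn_mem_cylinder (x : ℤ → A) (n : ℕ) :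
    DependsOn (fun y => y ∈ cylinder x n) (Set.Icc 1 (n : ℤ)) := by
  intro y z h
  refine propext (forall_congr' fun i => forall₂_congr fun h1 h2 => ?_)
  rw [h i ⟨h1, h2⟩]

variable [MeasurableSpace A]

lemma coordSigma_le (S : Set ℤ) : coordSigma A S ≤ MeasurableSpace.pi :=
  iSup₂_le fun i _ => le_iSup (fun i : ℤ => MeasurableSpace.comap (fun x : ℤ → A => x i) _) i

lemma coordSigma_mono {S T : Set ℤ} (h : S ⊆ T) : coordSigma A S ≤ coordSigma A T :=
  biSup_mono h

lemma wordProb_eq (P : Measure (ℤ → A)) (x : ℤ → A) (n : ℕ) :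
    wordProb P x n = P.real (cylinder x n) := rfl

lemma measurable_restrict_coordSigma (S : Set ℤ) :
    Measurable[coordSigma A S] (fun (x : ℤ → A) (i : S) => x i) := by
  refine @measurable_pi_lambda _ _ _ (coordSigma A S) _ _ fun i => ?_
  refine Measurable.mono (comap_measurable (fun x : ℤ → A => x i)) ?_ le_rfl
  exact le_iSup₂ (f := fun (i : ℤ) (_ : i ∈ S) =>
    MeasurableSpace.comap (fun x : ℤ → A => x i) _) (i : ℤ) i.2

lemma measurable_restrict (S : Set ℤ) : Measurable (fun (x : ℤ → A) (i : S) => x i) :=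
  (measurable_restrict_coordSigma S).mono (coordSigma_le S) le_rfl

lemma measurable_shiftBy (a : ℤ) : Measurable (shiftBy a : (ℤ → A) → (ℤ → A)) :=
  measurable_pi_lambda _ fun i => measurable_pi_apply (i + a)

variable [Fintype A] [MeasurableSingletonClass A]

lemma measurableSet_coordSigma_of_dependsOn {S : Set ℤ} (hS : S.Finite) {p : (ℤ → A) → Prop}
    (hp : DependsOn p S) : MeasurableSet[coordSigma A S] {x | p x} := by
  have := hS.to_subtype
  have h : {x | p x} = (fun (x : ℤ → A) (i : S) => x i) ⁻¹'
      ((fun (x : ℤ → A) (i : S) => x i) '' {x | p x}) := by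
    refine Set.Subset.antisymm (Set.subset_preimage_image _ _) ?_
    rintro x ⟨y, hy, hxy⟩
    have : p y = p x := hp fun i hi => congrFun hxy ⟨i, hi⟩
    exact (iff_of_eq this).1 hy
  rw [h]
  exact measurable_restrict_coordSigma S (Set.toFinite _).measurableSet

lemma measurableSet_of_dependsOn {S : Set ℤ} (hS : S.Finite) {p : (ℤ → A) → Prop}
    (hp : DependsOn p S) : MeasurableSet {x | p x} :=
  coordSigma_le S _ (measurableSet_coordSigma_of_dependsOn hS hp)

lemma measurable_of_dependsOn {γ : Type*} [MeasurableSpace γ] {S : Set ℤ} (hS : S.Finite)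
    {f : (ℤ → A) → γ} (hf : DependsOn f S) : Measurable f := fun t _ =>
  measurableSet_of_dependsOn hS (p := fun x => f x ∈ t) fun _ _ h => congrArg (· ∈ t) (hf h)

lemma measurableSet_prod_of_dependsOn {S T : Set ℤ} (hS : S.Finite) (hT : T.Finite)
    {r : (ℤ → A) → (ℤ → A) → Prop} (h₁ : ∀ y, DependsOn (fun x => r x y) S)
    (h₂ : ∀ x, DependsOn (r x) T) :
    MeasurableSet {ω : (ℤ → A) × (ℤ → A) | r ω.1 ω.2} := by
  have := hS.to_subtype
  have := hT.to_subtype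
  let π : (ℤ → A) × (ℤ → A) → (S → A) × (T → A) := fun ω => (fun i => ω.1 i, fun i => ω.2 i)
  have hπ : Measurable π := ((measurable_restrict S).comp measurable_fst).prodMk
    ((measurable_restrict T).comp measurable_snd)
  have h : {ω : (ℤ → A) × (ℤ → A) | r ω.1 ω.2} = π ⁻¹' (π '' {ω | r ω.1 ω.2}) := by
    refine Set.Subset.antisymm (Set.subset_preimage_image _ _) ?_
    rintro ⟨x, y⟩ ⟨⟨x', y'⟩, hr, hxy⟩
    have e₁ : r x' y' = r x y' := h₁ y' fun i hi => congrFun (congrArg Prod.fst hxy) ⟨i, hi⟩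
    have e₂ : r x y' = r x y := h₂ x fun i hi => congrFun (congrArg Prod.snd hxy) ⟨i, hi⟩
    exact (iff_of_eq (e₁.trans e₂)).1 hr
  rw [h]
  exact hπ (Set.toFinite _).measurableSet

lemma measurableSet_cylinder (x : ℤ → A) (n : ℕ) : MeasurableSet (cylinder x n) :=
  measurableSet_of_dependsOn (Set.finite_Icc _ _) (dependsOn_mem_cylinder x n)

end Coordinates

/-! ### Sources with ratio mixing -/

variable {A : Type*} [MeasurableSpace A]

/-- The part of the definition of the class of vanishing memory sources on which the convergence of
the match lengths rests: stationarity, the resulting lower bound for the probability of prolonging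
a word, and the mixing condition in product form, with the past ending at an arbitrary time. -/
structure RatioMixing (k₀ : ℕ) (β δ : ℝ) (P : Measure (ℤ → A)) : Prop where
  isProb : IsProbabilityMeasure P
  measurePreserving : ∀ a : ℤ, MeasurePreserving (shiftBy a) P P
  wordProb_succ : ∀ x n, δ * wordProb P x n ≤ wordProb P x (n + 1)
  lower : ∀ (a : ℤ) (E F : Set (ℤ → A)), MeasurableSet[coordSigma A {i | i ≤ a}] E →
    MeasurableSet[coordSigma A {i | a + k₀ ≤ i}] F → P.real E * P.real F ≤ β * P.real (E ∩ F)
  upper : ∀ (a : ℤ) (E F : Set (ℤ → A)), MeasurableSet[coordSigma A {i | i ≤ a}] E →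
    MeasurableSet[coordSigma A {i | a + k₀ ≤ i}] F → P.real (E ∩ F) ≤ β * (P.real E * P.real F)

lemma measurable_shiftBy_coordSigma (a : ℤ) {S T : Set ℤ} (h : ∀ i ∈ T, i + a ∈ S) :
    Measurable[coordSigma A S, coordSigma A T] (shiftBy a : (ℤ → A) → ℤ → A) := by
  rw [measurable_iff_comap_le, MeasurableSpace.comap_iSup]
  refine iSup_le fun i => ?_
  rw [MeasurableSpace.comap_iSup]
  refine iSup_le fun hi => ?_
  rw [MeasurableSpace.comap_comp]
  exact le_iSup₂ (f := fun (i : ℤ) (_ : i ∈ S) =>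
    MeasurableSpace.comap (fun x : ℤ → A => x i) _) (i + a) (h i hi)

lemma measurePreserving_shiftBy {P : Measure (ℤ → A)} (hP : MeasurePreserving shift P P) (a : ℤ) :
    MeasurePreserving (shiftBy a) P P := by
  have hnat : ∀ n : ℕ, MeasurePreserving (shiftBy (n : ℤ)) P P := by
    intro n
    induction n with
    | zero =>
      have : (shiftBy ((0 : ℕ) : ℤ) : (ℤ → A) → ℤ → A) = id := by
        funext x; exact shiftBy_zero x
      rw [this]; exact MeasurePreserving.id P
    | succ n ih =>
      have : (shiftBy ((n + 1 : ℕ) : ℤ) : (ℤ → A) → ℤ → A) = shiftBy (n : ℤ) ∘ shift := by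
        funext x i; simp [shiftBy, shift, add_assoc]
      rw [this]; exact ih.comp hP
  obtain ⟨n, rfl | rfl⟩ := a.eq_nat_or_neg
  · exact hnat n
  · refine ⟨measurable_shiftBy _, ?_⟩
    conv_lhs => rw [← (hnat n).map_eq]
    rw [Measure.map_map (measurable_shiftBy _) (measurable_shiftBy _)]
    have : (shiftBy (-(n : ℤ)) ∘ shiftBy (n : ℤ) : (ℤ → A) → ℤ → A) = id := by
      funext x; simp [shiftBy_shiftBy, shiftBy_zero]
    rw [this, Measure.map_id]

lemma RatioMixing.measureReal_shiftBy {k₀ : ℕ} {β δ : ℝ} {P : Measure (ℤ → A)}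
    (hP : RatioMixing k₀ β δ P) (a : ℤ) {E : Set (ℤ → A)} (hE : MeasurableSet E) :
    P.real (shiftBy a ⁻¹' E) = P.real E :=
  (hP.measurePreserving a).measureReal_preimage hE.nullMeasurableSet

section FromClass

variable {k₀ : ℕ} {α β δ R : ℝ} {ℓ n₀ : ℕ} {P : Measure (ℤ → A)}

/-- The mixing condition at time `0`, with the quotient of probabilities cleared; a quotient with
denominator `0` is excluded by the lower bound. -/
lemma IsVanishingMemory.mixing_mul (hP : IsVanishingMemory k₀ α β δ R ℓ n₀ P) (hβ : 0 < β)
    {E F : Set (ℤ → A)} (hE : MeasurableSet[coordSigma A {i | i ≤ 0}] E)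
    (hF : MeasurableSet[coordSigma A {i | (k₀ : ℤ) ≤ i}] F) :
    P.real E * P.real F ≤ β * P.real (E ∩ F) ∧ P.real (E ∩ F) ≤ β * (P.real E * P.real F) := by
  have := hP.isProb
  have hEF0 : 0 ≤ P.real (E ∩ F) := measureReal_nonneg
  rcases eq_or_lt_of_le (measureReal_nonneg (μ := P) (s := E)) with h0 | hE0
  · have h1 : P.real (E ∩ F) ≤ P.real E := measureReal_mono Set.inter_subset_left
    have h2 : P.real (E ∩ F) = 0 := by linarith
    rw [h2, ← h0]; simp
  rcases eq_or_lt_of_le (measureReal_nonneg (μ := P) (s := F)) with h0 | hF0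
  · have h1 : P.real (E ∩ F) ≤ P.real F := measureReal_mono Set.inter_subset_right
    have h2 : P.real (E ∩ F) = 0 := by linarith
    rw [h2, ← h0]; simp
  obtain ⟨h1, h2⟩ := hP.mixing k₀ le_rfl E F hE hF hE0 hF0
  have hc : (ProbabilityTheory.cond P E).real F = (P.real E)⁻¹ * P.real (E ∩ F) := by
    rw [measureReal_def, ProbabilityTheory.cond_apply (coordSigma_le _ _ hE), ENNReal.toReal_mul,
      ENNReal.toReal_inv]
    rfl
  rw [hc] at h1 h2
  rcases eq_or_lt_of_le hEF0 with h0 | hpos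
  · rw [← h0] at h1
    have : 0 < 1 / β := by positivity
    simp at h1
    exact absurd h1 (not_le.2 (by simpa using this))
  rw [div_le_iff₀ (by positivity)] at h2
  rw [le_div_iff₀ (by positivity)] at h1
  have e : (P.real E)⁻¹ * P.real (E ∩ F) * P.real E = P.real (E ∩ F) := by
    field_simp
  constructor
  · calc P.real E * P.real F ≤ P.real E * (β * ((P.real E)⁻¹ * P.real (E ∩ F))) := by gcongr
      _ = β * ((P.real E)⁻¹ * P.real (E ∩ F) * P.real E) := by ring
      _ = _ := by rw [e]
  · calc P.real (E ∩ F) = β * P.real E * (1 / β * ((P.real E)⁻¹ * P.real (E ∩ F))) := by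
          field_simp
      _ ≤ β * P.real E * P.real F := by gcongr
      _ = _ := by ring

variable [Fintype A] [MeasurableSingletonClass A]

lemma IsVanishingMemory.wordProb_succ (hP : IsVanishingMemory k₀ α β δ R ℓ n₀ P)
    (x : ℤ → A) (n : ℕ) : δ * wordProb P x n ≤ wordProb P x (n + 1) := by
  have := hP.isProb
  have hsh := measurePreserving_shiftBy hP.ergodic.toMeasurePreserving (n : ℤ)
  -- the word is moved so that its last letter is at position `1`
  set V : Set (ℤ → A) := {y | ∀ i : ℤ, 1 - (n : ℤ) ≤ i → i ≤ 0 → y i = x (i + n)} with hV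
  have hVdep : DependsOn (fun y => y ∈ V) (Set.Icc (1 - (n : ℤ)) 0) := by
    intro y z h
    refine propext (forall_congr' fun i => forall₂_congr fun h1 h2 => ?_)
    rw [h i ⟨h1, h2⟩]
  have hVm : MeasurableSet[coordSigma A {i | i ≠ 1}] V :=
    coordSigma_mono (fun i hi => by simp only [Set.mem_Icc, Set.mem_ofPred_eq] at *; omega) _
      (measurableSet_coordSigma_of_dependsOn (Set.finite_Icc _ _) hVdep)
  have hVm' := coordSigma_le _ _ hVm
  set a := x (n + 1)
  have hm : MeasurableSet {y : ℤ → A | y 1 = a} := by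
    have : Measurable fun y : ℤ → A => y 1 := measurable_pi_apply (1 : ℤ)
    exact this (measurableSet_singleton a)
  have e1 : cylinder x n = shiftBy (n : ℤ) ⁻¹' V := by
    ext y
    constructor
    · intro h i h1 h2
      exact h (i + n) (by omega) (by omega)
    · intro h i h1 h2
      have := h (i - n) (by omega) (by omega)
      simpa [shiftBy] using this
  have e2 : cylinder x (n + 1) = shiftBy (n : ℤ) ⁻¹' (V ∩ {y | y 1 = a}) := by
    ext y
    constructor
    · intro h
      refine ⟨fun i h1 h2 => h (i + n) (by omega) (by push_cast; omega), ?_⟩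
      have := h (1 + n) (by omega) (by push_cast; omega)
      simpa [shiftBy, a, add_comm] using this
    · rintro ⟨h, h'⟩ i h1 h2
      rcases eq_or_ne i (n + 1) with rfl | hne
      · simpa [shiftBy, a, add_comm] using h'
      · push_cast at h2
        have := h (i - n) (by omega) (by omega)
        simpa [shiftBy] using this
  rw [wordProb_eq, wordProb_eq, e1, e2, hsh.measureReal_preimage hVm'.nullMeasurableSet,
    hsh.measureReal_preimage (hVm'.inter hm).nullMeasurableSet]
  have hint : Integrable ({y : ℤ → A | y 1 = a}.indicator (fun _ => (1 : ℝ))) P :=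
    (integrable_const 1).indicator hm
  have key := setIntegral_condExp (coordSigma_le {i | i ≠ 1}) hint hVm
  have hr : ∫ y in V, ({y : ℤ → A | y 1 = a}.indicator (fun _ => (1 : ℝ))) y ∂P
      = P.real (V ∩ {y | y 1 = a}) := by
    rw [setIntegral_indicator hm]; simp
  rw [← hr, ← key]
  calc δ * P.real V = ∫ y in V, δ ∂P := by simp [mul_comm]
    _ ≤ _ := setIntegral_mono_ae (integrable_const δ).integrableOn
      integrable_condExp.integrableOn (hP.positive a)

lemma IsVanishingMemory.ratioMixing (hP : IsVanishingMemory k₀ α β δ R ℓ n₀ P) (hβ : 0 < β)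
    {β' : ℝ} (hβ' : β ≤ β') : RatioMixing k₀ β' δ P := by
  have := hP.isProb
  have hsh := measurePreserving_shiftBy hP.ergodic.toMeasurePreserving
  have key : ∀ (a : ℤ) (E F : Set (ℤ → A)), MeasurableSet[coordSigma A {i | i ≤ a}] E →
      MeasurableSet[coordSigma A {i | a + k₀ ≤ i}] F →
      P.real E * P.real F ≤ β * P.real (E ∩ F) ∧
      P.real (E ∩ F) ≤ β * (P.real E * P.real F) := by
    intro a E F hE hF
    have h := hP.mixing_mul hβ (E := shiftBy (-a) ⁻¹' E) (F := shiftBy (-a) ⁻¹' F)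
      (measurable_shiftBy_coordSigma (-a) (fun i hi => by
        simp only [Set.mem_ofPred_eq] at *; omega) hE)
      (measurable_shiftBy_coordSigma (-a) (fun i hi => by
        simp only [Set.mem_ofPred_eq] at *; omega) hF)
    rw [← Set.preimage_inter] at h
    have hE' := coordSigma_le _ _ hE
    have hF' := coordSigma_le _ _ hF
    rwa [(hsh (-a)).measureReal_preimage hE'.nullMeasurableSet,
      (hsh (-a)).measureReal_preimage hF'.nullMeasurableSet,
      (hsh (-a)).measureReal_preimage (hE'.inter hF').nullMeasurableSet] at h
  refine ⟨hP.isProb, hsh, hP.wordProb_succ, fun a E F hE hF => ?_, fun a E F hE hF => ?_⟩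
  · exact (key a E F hE hF).1.trans (by gcongr)
  · exact (key a E F hE hF).2.trans (by gcongr)

end FromClass

/-! ### Decoupling of past and future -/

variable {A : Type*} [Fintype A] [MeasurableSpace A] [MeasurableSingletonClass A]
  {k₀ : ℕ} {β δ : ℝ} {P : Measure (ℤ → A)}

lemma exists_bound_of_dependsOn {A : Type*} [Fintype A] {S : Set ℤ} (hS : S.Finite) {f : (ℤ → A) → ℝ}
    (hf : DependsOn f S) : ∃ C, ∀ x, |f x| ≤ C := by
  have := hS.to_subtype
  obtain ⟨g, rfl⟩ := dependsOn_iff_exists_comp.1 hf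
  obtain ⟨C, hC⟩ := (Set.finite_range fun u => |g u|).bddAbove
  exact ⟨C, fun x => hC ⟨_, rfl⟩⟩

lemma integrable_of_dependsOn [IsFiniteMeasure P] {S : Set ℤ} (hS : S.Finite) {f : (ℤ → A) → ℝ}
    (hf : DependsOn f S) : Integrable f P := by
  obtain ⟨C, hC⟩ := exists_bound_of_dependsOn hS hf
  exact Integrable.of_bound (measurable_of_dependsOn hS hf).aestronglyMeasurable C
    (ae_of_all _ hC)

lemma dependsOn_restrict_eq {A : Type*} (S : Set ℤ) (u : S → A) :
    DependsOn (fun x : ℤ → A => (fun i : S => x i) = u) S := by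
  intro x y h
  have : (fun i : S => x i) = fun i : S => y i := funext fun i => h i i.2
  exact congrArg (· = u) this

/-- In the probability that the past and the future of one sequence are in some relation, the past
may be replaced by an independent copy, at the cost of the factor `β`. -/
lemma RatioMixing.measureReal_le_of_forall (hP : RatioMixing k₀ β δ P) (hβ : 0 ≤ β) {S T : Set ℤ}
    (hS : S.Finite) (hT : T.Finite) {a : ℤ} (hSa : ∀ i ∈ S, i ≤ a) (hTa : ∀ i ∈ T, a + k₀ ≤ i)
    {r : (ℤ → A) → (ℤ → A) → Prop} (h₁ : ∀ y, DependsOn (fun x => r x y) S)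
    (h₂ : ∀ x, DependsOn (r x) T) {c : ℝ} (hc : ∀ y, P.real {x | r x y} ≤ c) :
    P.real {x | r x x} ≤ β * c := by
  classical
  have := hP.isProb
  have := hT.to_subtype
  have := Fintype.ofFinite T
  obtain ⟨x₀⟩ : Nonempty (ℤ → A) := nonempty_of_isProbabilityMeasure P
  let e : (T → A) → ℤ → A := fun u i => if h : i ∈ T then u ⟨i, h⟩ else x₀ i
  let F : (T → A) → Set (ℤ → A) := fun u => {x | (fun i : T => x i) = u}
  have hF : ∀ u, MeasurableSet[coordSigma A {i | a + k₀ ≤ i}] (F u) := fun u =>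
    coordSigma_mono hTa _ (measurableSet_coordSigma_of_dependsOn hT (dependsOn_restrict_eq T u))
  have hE : ∀ u, MeasurableSet[coordSigma A {i | i ≤ a}] {x | r x (e u)} := fun u =>
    coordSigma_mono hSa _ (measurableSet_coordSigma_of_dependsOn hS (h₁ _))
  have hsub : {x | r x x} ⊆ ⋃ u : T → A, {x | r x (e u)} ∩ F u := by
    intro x hx
    refine Set.mem_iUnion.2 ⟨fun i => x i, ?_, rfl⟩
    have : r x (e fun i => x i) = r x x := h₂ x fun i hi => by simp [e, hi]
    exact (iff_of_eq this).2 hx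
  have hsum : ∑ u : T → A, P.real (F u) = 1 := by
    have := sum_measureReal_preimage_singleton (μ := P)
      (f := fun (x : ℤ → A) (i : T) => x i) Finset.univ
      (fun u _ => measurable_restrict T (measurableSet_singleton u))
    simp only [Finset.coe_univ, Set.preimage_univ, probReal_univ] at this
    exact this
  calc P.real {x | r x x} ≤ P.real (⋃ u : T → A, {x | r x (e u)} ∩ F u) := measureReal_mono hsub
    _ ≤ ∑ u : T → A, P.real ({x | r x (e u)} ∩ F u) := measureReal_iUnion_fintype_le _
    _ ≤ ∑ u : T → A, β * (c * P.real (F u)) := by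
        refine Finset.sum_le_sum fun u _ => (hP.upper a _ _ (hE u) (hF u)).trans ?_
        gcongr
        exact hc _
    _ = β * c := by rw [← Finset.mul_sum, ← Finset.mul_sum, hsum, mul_one]

/-- For centred functions `f` of the past and `g` of the future, the mean square of `f - g` is at
least `1 / β` times its value for independent arguments. -/
lemma RatioMixing.integral_sq_add_le (hP : RatioMixing k₀ β δ P) {S T : Set ℤ}
    (hS : S.Finite) (hT : T.Finite) {a : ℤ} (hSa : ∀ i ∈ S, i ≤ a) (hTa : ∀ i ∈ T, a + k₀ ≤ i)
    {f g : (ℤ → A) → ℝ} (hf : DependsOn f S) (hg : DependsOn g T)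
    (hf0 : ∫ x, f x ∂P = 0) (hg0 : ∫ x, g x ∂P = 0) :
    ∫ x, f x ^ 2 ∂P + ∫ x, g x ^ 2 ∂P ≤ β * ∫ x, (f x - g x) ^ 2 ∂P := by
  have := hP.isProb
  have := hS.to_subtype
  have := hT.to_subtype
  have := Fintype.ofFinite S
  have := Fintype.ofFinite T
  obtain ⟨f, rfl⟩ := dependsOn_iff_exists_comp.1 hf
  obtain ⟨g, rfl⟩ := dependsOn_iff_exists_comp.1 hg
  let X : (ℤ → A) → S → A := fun x i => x i
  let Y : (ℤ → A) → T → A := fun x i => x i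
  have hX : Measurable X := measurable_restrict S
  have hY : Measurable Y := measurable_restrict T
  let p : (S → A) → ℝ := fun u => P.real (X ⁻¹' {u})
  let q : (T → A) → ℝ := fun v => P.real (Y ⁻¹' {v})
  let w : (S → A) → (T → A) → ℝ := fun u v => P.real (X ⁻¹' {u} ∩ Y ⁻¹' {v})
  have hw : ∀ u v, p u * q v ≤ β * w u v := fun u v => by
    refine hP.lower a _ _ (coordSigma_mono hSa _ ?_) (coordSigma_mono hTa _ ?_)
    · exact measurableSet_coordSigma_of_dependsOn hS (dependsOn_restrict_eq S u)
    · exact measurableSet_coordSigma_of_dependsOn hT (dependsOn_restrict_eq T v)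
  have IX : ∀ h : (S → A) → ℝ, ∫ x, h (X x) ∂P = ∑ u, p u * h u := fun h => by
    have := Measure.isProbabilityMeasure_map (μ := P) hX.aemeasurable
    rw [← integral_map hX.aemeasurable (Measurable.of_discrete).aestronglyMeasurable,
      integral_fintype Integrable.of_finite]
    simp [p, map_measureReal_apply hX (measurableSet_singleton _)]
  have IY : ∀ h : (T → A) → ℝ, ∫ x, h (Y x) ∂P = ∑ v, q v * h v := fun h => by
    have := Measure.isProbabilityMeasure_map (μ := P) hY.aemeasurable
    rw [← integral_map hY.aemeasurable (Measurable.of_discrete).aestronglyMeasurable,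
      integral_fintype Integrable.of_finite]
    simp [q, map_measureReal_apply hY (measurableSet_singleton _)]
  have IXY : ∀ h : (S → A) × (T → A) → ℝ,
      ∫ x, h (X x, Y x) ∂P = ∑ u, ∑ v, w u v * h (u, v) := fun h => by
    have hXY := hX.prodMk hY
    have := Measure.isProbabilityMeasure_map (μ := P) hXY.aemeasurable
    rw [← integral_map (φ := fun x => (X x, Y x)) hXY.aemeasurable
      (Measurable.of_discrete).aestronglyMeasurable,
      integral_fintype Integrable.of_finite, Fintype.sum_prod_type]
    refine Finset.sum_congr rfl fun u _ => Finset.sum_congr rfl fun v _ => ?_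
    rw [map_measureReal_apply hXY (measurableSet_singleton _), smul_eq_mul]
    congr 2
    ext x; simp
  have hp1 : ∑ u, p u = 1 := by simpa using (IX fun _ => 1).symm
  have hq1 : ∑ v, q v = 1 := by simpa using (IY fun _ => 1).symm
  have hf0' : ∑ u, p u * f u = 0 := (IX f).symm.trans hf0
  have hg0' : ∑ v, q v * g v = 0 := (IY g).symm.trans hg0
  have e1 : ∫ x, (f (X x)) ^ 2 ∂P = ∑ u, p u * f u ^ 2 := IX fun u => f u ^ 2
  have e2 : ∫ x, (g (Y x)) ^ 2 ∂P = ∑ v, q v * g v ^ 2 := IY fun v => g v ^ 2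
  have e3 : ∫ x, (f (X x) - g (Y x)) ^ 2 ∂P = ∑ u, ∑ v, w u v * (f u - g v) ^ 2 :=
    IXY fun z => (f z.1 - g z.2) ^ 2
  change ∫ x, (f (X x)) ^ 2 ∂P + ∫ x, (g (Y x)) ^ 2 ∂P ≤ β * ∫ x, (f (X x) - g (Y x)) ^ 2 ∂P
  rw [e1, e2, e3]
  calc ∑ u, p u * f u ^ 2 + ∑ v, q v * g v ^ 2
      = (∑ u, p u * f u ^ 2) * (∑ v, q v) + (∑ u, p u) * (∑ v, q v * g v ^ 2)
        - 2 * ((∑ u, p u * f u) * (∑ v, q v * g v)) := by rw [hp1, hq1, hf0']; ring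
    _ = ∑ u, ∑ v, p u * q v * (f u - g v) ^ 2 := by
        rw [Finset.sum_mul_sum, Finset.sum_mul_sum, Finset.sum_mul_sum, Finset.mul_sum,
          ← Finset.sum_add_distrib, ← Finset.sum_sub_distrib]
        refine Finset.sum_congr rfl fun u _ => ?_
        rw [Finset.mul_sum, ← Finset.sum_add_distrib, ← Finset.sum_sub_distrib]
        refine Finset.sum_congr rfl fun v _ => ?_
        ring
    _ ≤ ∑ u, ∑ v, β * w u v * (f u - g v) ^ 2 := by
        refine Finset.sum_le_sum fun u _ => Finset.sum_le_sum fun v _ => ?_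
        exact mul_le_mul_of_nonneg_right (hw u v) (sq_nonneg _)
    _ = _ := by simp only [Finset.mul_sum, mul_assoc]

/-! ### Concentration of ergodic averages -/

lemma RatioMixing.integral_shiftBy {A : Type*} [MeasurableSpace A] {k₀ : ℕ} {β δ : ℝ}
    {P : Measure (ℤ → A)} (hP : RatioMixing k₀ β δ P) (a : ℤ) {f : (ℤ → A) → ℝ}
    (hf : Measurable f) : ∫ x, f (shiftBy a x) ∂P = ∫ x, f x ∂P := by
  conv_rhs => rw [← (hP.measurePreserving a).map_eq]
  rw [integral_map (measurable_shiftBy a).aemeasurable hf.aestronglyMeasurable]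

/-- Averaging a centred function `f` of the past with a shifted copy which belongs to the future
reduces the mean square by a factor less than `1`. -/
lemma RatioMixing.integral_sq_average_le (hP : RatioMixing k₀ β δ P) (hβ : 1 ≤ β) {W d : ℤ}
    (hd : W + k₀ ≤ d + 1) {f : (ℤ → A) → ℝ} (hf : DependsOn f (Set.Icc 1 W))
    (hf0 : ∫ x, f x ∂P = 0) :
    ∫ x, ((f x + f (shiftBy d x)) / 2) ^ 2 ∂P ≤ (1 - 1 / (2 * β)) * ∫ x, f x ^ 2 ∂P := by
  have := hP.isProb
  have hfm := measurable_of_dependsOn (Set.finite_Icc _ _) hf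
  set g : (ℤ → A) → ℝ := fun x => f (shiftBy d x) with hg
  have hgd : DependsOn g (Set.Icc (1 + d) (W + d)) :=
    DependsOn.comp_shiftBy hf d fun i hi => by simp only [Set.mem_Icc] at *; omega
  have hgm := measurable_of_dependsOn (Set.finite_Icc _ _) hgd
  have hg0 : ∫ x, g x ∂P = 0 := (hP.integral_shiftBy d hfm).trans hf0
  have hg2 : ∫ x, g x ^ 2 ∂P = ∫ x, f x ^ 2 ∂P :=
    hP.integral_shiftBy d (f := fun x => f x ^ 2) (hfm.pow_const 2)
  have key := hP.integral_sq_add_le (Set.finite_Icc _ _) (Set.finite_Icc _ _) (a := W)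
    (fun i hi => hi.2) (fun i hi => by simp only [Set.mem_Icc] at hi; omega) hf hgd hf0 hg0
  have hfd := hf.mono (t := Set.Icc 1 W ∪ Set.Icc (1 + d) (W + d)) Set.subset_union_left
  have hgd' := hgd.mono (t := Set.Icc 1 W ∪ Set.Icc (1 + d) (W + d)) Set.subset_union_right
  have hU : (Set.Icc 1 W ∪ Set.Icc (1 + d) (W + d)).Finite :=
    (Set.finite_Icc _ _).union (Set.finite_Icc _ _)
  have i1 : Integrable (fun x => f x ^ 2) P := integrable_of_dependsOn hU
    fun x y h => congrArg (· ^ 2) (hfd h)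
  have i2 : Integrable (fun x => g x ^ 2) P := integrable_of_dependsOn hU
    fun x y h => congrArg (· ^ 2) (hgd' h)
  have i12 : Integrable (fun x => f x ^ 2 + g x ^ 2) P := i1.add i2
  have i3 : Integrable (fun x => (f x - g x) ^ 2) P := integrable_of_dependsOn hU
    fun x y h => by simp only [hfd h, hgd' h]
  have hpar : ∫ x, ((f x + g x) / 2) ^ 2 ∂P
      = (1 / 2) * (∫ x, f x ^ 2 ∂P + ∫ x, g x ^ 2 ∂P) - (1 / 4) * ∫ x, (f x - g x) ^ 2 ∂P := by
    rw [← integral_add i1 i2, ← integral_const_mul, ← integral_const_mul,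
      ← integral_sub (i12.const_mul _) (i3.const_mul _)]
    refine integral_congr_ae (ae_of_all _ fun x => ?_)
    simp only
    ring
  rw [hpar, hg2]
  rw [hg2] at key
  have : (2 * ∫ x, f x ^ 2 ∂P) / β ≤ ∫ x, (f x - g x) ^ 2 ∂P := by
    rw [div_le_iff₀ (by linarith)]; linarith
  have e : (1 - 1 / (2 * β)) * ∫ x, f x ^ 2 ∂P
      = ∫ x, f x ^ 2 ∂P - 1 / 4 * ((2 * ∫ x, f x ^ 2 ∂P) / β) := by
    field_simp; ring
  rw [e]; linarith

lemma abs_sum_shift_sub_le {u : ℕ → ℝ} {B : ℝ} (hu : ∀ i, |u i| ≤ B) (N d : ℕ) :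
    |∑ i ∈ Finset.range N, u (i + d) - ∑ i ∈ Finset.range N, u i| ≤ 2 * B * d := by
  induction d with
  | zero => simp
  | succ d ih =>
    have h1 := Finset.sum_range_succ (fun i => u (i + d)) N
    have h2 := Finset.sum_range_succ' (fun i => u (i + d)) N
    have h3 : ∀ i, u (i + 1 + d) = u (i + (d + 1)) := fun i => by congr 1; ring
    simp only [h3, zero_add] at h2
    have h4 := hu (N + d)
    have h5 := hu d
    push_cast
    rw [abs_le] at *
    constructor <;> linarith

/-- Iterated averaging over `2 ^ k` copies of `f` with gaps: the mean square decays
geometrically in `k`, while the sums along an orbit change by a bounded amount only. -/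
lemma RatioMixing.exists_iterated_average (hP : RatioMixing k₀ β δ P) (hβ : 1 ≤ β) {L : ℕ} {B : ℝ}
    {f : (ℤ → A) → ℝ} (hf : DependsOn f (Set.Icc 1 (L : ℤ))) (hf0 : ∫ x, f x ∂P = 0)
    (hB : ∀ x, |f x| ≤ B) (k : ℕ) :
    ∃ F : (ℤ → A) → ℝ, DependsOn F (Set.Icc 1 ((2 ^ k * (L + k₀) - k₀ : ℤ))) ∧
      ∫ x, F x ∂P = 0 ∧ (∀ x, |F x| ≤ B) ∧
      ∫ x, F x ^ 2 ∂P ≤ (1 - 1 / (2 * β)) ^ k * B ^ 2 ∧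
      ∀ (N : ℕ) (x : ℤ → A), |∑ i ∈ Finset.range N, F (shiftBy (i : ℤ) x) -
        ∑ i ∈ Finset.range N, f (shiftBy (i : ℤ) x)| ≤ B * (2 ^ k * (L + k₀)) := by
  have := hP.isProb
  obtain ⟨x₀⟩ : Nonempty (ℤ → A) := nonempty_of_isProbabilityMeasure P
  have hB0 : 0 ≤ B := (abs_nonneg _).trans (hB x₀)
  have hρ : 0 ≤ 1 - 1 / (2 * β) := by
    have : 1 / (2 * β) ≤ 1 := by rw [div_le_one (by linarith)]; linarith
    linarith
  -- the error bound is tracked in the sharper form `2 ^ k * (L + k₀) - k₀ - L`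
  suffices h : ∃ F : (ℤ → A) → ℝ, DependsOn F (Set.Icc 1 ((2 ^ k * (L + k₀) - k₀ : ℤ))) ∧
      ∫ x, F x ∂P = 0 ∧ (∀ x, |F x| ≤ B) ∧
      ∫ x, F x ^ 2 ∂P ≤ (1 - 1 / (2 * β)) ^ k * B ^ 2 ∧
      ∀ (N : ℕ) (x : ℤ → A), |∑ i ∈ Finset.range N, F (shiftBy (i : ℤ) x) -
        ∑ i ∈ Finset.range N, f (shiftBy (i : ℤ) x)| ≤ B * (2 ^ k * (L + k₀) - k₀ - L) by
    obtain ⟨F, h1, h2, h3, h4, h5⟩ := h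
    refine ⟨F, h1, h2, h3, h4, fun N x => (h5 N x).trans ?_⟩
    refine mul_le_mul_of_nonneg_left ?_ hB0
    have : (0 : ℝ) ≤ (L : ℝ) + k₀ := by positivity
    linarith
  induction k with
  | zero =>
    refine ⟨f, by simpa using hf, hf0, hB, ?_, fun N x => by simp⟩
    have hi : Integrable (fun x => f x ^ 2) P := integrable_of_dependsOn (Set.finite_Icc _ _)
      fun x y h => congrArg (· ^ 2) (hf h)
    calc ∫ x, f x ^ 2 ∂P ≤ ∫ _, B ^ 2 ∂P :=
          integral_mono hi (integrable_const _) fun x => sq_le_sq.2 (by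
            rw [abs_of_nonneg hB0]; exact hB x)
      _ = _ := by simp
  | succ k ih =>
    obtain ⟨F, h1, h2, h3, h4, h5⟩ := ih
    set d : ℕ := 2 ^ k * (L + k₀) with hd
    have hFm := measurable_of_dependsOn (Set.finite_Icc _ _) h1
    have hdep : DependsOn (fun x => (F x + F (shiftBy d x)) / 2)
        (Set.Icc 1 ((2 ^ (k + 1) * (L + k₀) - k₀ : ℤ))) := by
      have e1 : DependsOn F (Set.Icc 1 ((2 ^ (k + 1) * (L + k₀) - k₀ : ℤ))) := by
        refine h1.mono (Set.Icc_subset_Icc le_rfl ?_)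
        have : (0 : ℤ) ≤ 2 ^ k * (L + k₀) := by positivity
        rw [pow_succ]; linarith
      have e2 : DependsOn (fun x => F (shiftBy d x))
          (Set.Icc 1 ((2 ^ (k + 1) * (L + k₀) - k₀ : ℤ))) := by
        refine DependsOn.comp_shiftBy h1 d fun i hi => ?_
        obtain ⟨hi1, hi2⟩ := hi
        refine ⟨by omega, ?_⟩
        rw [hd]; push_cast; rw [pow_succ]; linarith
      intro x y h
      simp only [e1 h, e2 h]
    refine ⟨fun x => (F x + F (shiftBy d x)) / 2, hdep, ?_, ?_, ?_, ?_⟩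
    · have i1 : Integrable F P := integrable_of_dependsOn (Set.finite_Icc _ _) h1
      have i2 : Integrable (fun x => F (shiftBy d x)) P :=
        (hP.measurePreserving d).integrable_comp_of_integrable i1
      rw [integral_div, integral_add i1 i2, hP.integral_shiftBy d hFm, h2]; simp
    · intro x
      have a1 := abs_le.1 (h3 x)
      have a2 := abs_le.1 (h3 (shiftBy d x))
      rw [abs_le]; constructor <;> linarith
    · refine (hP.integral_sq_average_le hβ ?_ h1 h2).trans ?_
      · rw [hd]; push_cast; linarith
      · rw [pow_succ' _ k, mul_assoc]
        exact mul_le_mul_of_nonneg_left h4 hρ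
    · intro N x
      have s1 := abs_sum_shift_sub_le (u := fun i => F (shiftBy (i : ℤ) x)) (fun i => h3 _) N d
      have s2 := h5 N x
      have e : ∀ i : ℕ, F (shiftBy (d : ℤ) (shiftBy (i : ℤ) x)) = F (shiftBy ((i + d : ℕ) : ℤ) x) :=
        fun i => by rw [shiftBy_shiftBy]; congr 2; push_cast; ring
      simp only [e, ← Finset.sum_div, Finset.sum_add_distrib]
      have hd' : (d : ℝ) = 2 ^ k * (L + k₀) := by rw [hd]; push_cast; ring
      rw [hd'] at s1
      rw [pow_succ]
      rw [abs_le] at *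
      constructor <;> nlinarith [s1.1, s1.2, s2.1, s2.2]

/-- The weak law of large numbers for functions of `L` letters, with an error probability that
depends only on the mixing constant and on the ratio `N / (L + k₀)`. -/
lemma exists_concentration (k₀ : ℕ) (hβ : 1 ≤ β) {τ η : ℝ} (hτ : 0 < τ) (hη : 0 < η) :
    ∃ C : ℝ, 0 < C ∧ ∀ (δ : ℝ) (P : Measure (ℤ → A)), RatioMixing k₀ β δ P →
      ∀ (L N : ℕ) (B : ℝ) (f : (ℤ → A) → ℝ), 0 < B → DependsOn f (Set.Icc 1 (L : ℤ)) →
        (∀ x, 0 ≤ f x ∧ f x ≤ B) → 0 < N → C * (L + k₀) ≤ N → ∀ a : ℤ,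
        P.real {x | τ * B ≤ |(1 / (N : ℝ)) * ∑ i ∈ Finset.range N, f (shiftBy (a + i) x)
          - ∫ x, f x ∂P|} ≤ η := by
  set ρ := 1 - 1 / (2 * β) with hρdef
  have hρ0 : 0 ≤ ρ := by
    have : 1 / (2 * β) ≤ 1 := by rw [div_le_one (by linarith)]; linarith
    linarith
  have hρ1 : ρ < 1 := by
    have : 0 < 1 / (2 * β) := by positivity
    linarith
  obtain ⟨k, hk⟩ := exists_pow_lt_of_lt_one (show 0 < η * (τ / 2) ^ 2 by positivity) hρ1
  refine ⟨2 / τ * 2 ^ k, by positivity, ?_⟩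
  intro δ P hP L N B f hB hf hfB hN hNL a
  have := hP.isProb
  have hN' : (0 : ℝ) < N := by exact_mod_cast hN
  have hfi : Integrable f P := integrable_of_dependsOn (Set.finite_Icc _ _) hf
  set m := ∫ x, f x ∂P with hm
  have hm0 : 0 ≤ m := integral_nonneg fun x => (hfB x).1
  have hmB : m ≤ B := by
    calc m ≤ ∫ _, B ∂P := integral_mono hfi (integrable_const _) fun x => (hfB x).2
      _ = B := by simp
  obtain ⟨F, h1, h2, h3, h4, h5⟩ := hP.exists_iterated_average hβ (f := fun x => f x - m) (B := B)
    (fun x y h => congrArg (· - m) (hf h)) (by rw [integral_sub hfi (integrable_const _)]; simp [hm])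
    (fun x => by
      have := hfB x
      rw [abs_le]; constructor <;> linarith) k
  have hFm := measurable_of_dependsOn (Set.finite_Icc _ _) h1
  have hF2 : Integrable (fun x => F x ^ 2) P := integrable_of_dependsOn (Set.finite_Icc _ _)
    fun x y h => congrArg (· ^ 2) (h1 h)
  set G : (ℤ → A) → ℝ := fun x => (1 / (N : ℝ)) * ∑ i ∈ Finset.range N, F (shiftBy (a + i) x)
  have hF2i : ∀ i : ℕ, Integrable (fun x => F (shiftBy (a + i) x) ^ 2) P := fun i =>
    (hP.measurePreserving (a + i)).integrable_comp_of_integrable hF2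
  have hsumi : Integrable (fun x => (1 / (N : ℝ)) *
      ∑ i ∈ Finset.range N, F (shiftBy (a + i) x) ^ 2) P :=
    (integrable_finsetSum _ fun i _ => hF2i i).const_mul _
  have hle : ∀ x, G x ^ 2 ≤ (1 / (N : ℝ)) * ∑ i ∈ Finset.range N, F (shiftBy (a + i) x) ^ 2 := by
    intro x
    have := sq_sum_le_card_mul_sum_sq (s := Finset.range N) (f := fun i => F (shiftBy (a + i) x))
    rw [Finset.card_range] at this
    calc G x ^ 2 = (1 / (N : ℝ)) ^ 2 * (∑ i ∈ Finset.range N, F (shiftBy (a + i) x)) ^ 2 := by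
          simp only [G, mul_pow]
      _ ≤ (1 / (N : ℝ)) ^ 2 * (N * ∑ i ∈ Finset.range N, F (shiftBy (a + i) x) ^ 2) := by gcongr
      _ = _ := by field_simp
  have hGm : Measurable G := (Finset.measurable_sum _ fun i _ =>
    hFm.comp (measurable_shiftBy _)).const_mul _
  have hGi : Integrable (fun x => G x ^ 2) P :=
    Integrable.mono' hsumi (hGm.pow_const 2).aestronglyMeasurable
      (ae_of_all _ fun x => by rw [Real.norm_of_nonneg (sq_nonneg _)]; exact hle x)
  have hG2 : ∫ x, G x ^ 2 ∂P ≤ ρ ^ k * B ^ 2 := by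
    calc ∫ x, G x ^ 2 ∂P ≤ ∫ x, (1 / (N : ℝ)) *
          ∑ i ∈ Finset.range N, F (shiftBy (a + i) x) ^ 2 ∂P := integral_mono hGi hsumi hle
      _ = (1 / (N : ℝ)) * ∑ i ∈ Finset.range N, ∫ x, F x ^ 2 ∂P := by
          rw [integral_const_mul, integral_finsetSum _ fun i _ => hF2i i]
          congr 1
          exact Finset.sum_congr rfl fun i _ =>
            hP.integral_shiftBy (a + i) (f := fun x => F x ^ 2) (hFm.pow_const 2)
      _ = ∫ x, F x ^ 2 ∂P := by simp; field_simp
      _ ≤ _ := h4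
  have hsub : {x | τ * B ≤ |(1 / (N : ℝ)) * ∑ i ∈ Finset.range N, f (shiftBy (a + i) x) - m|}
      ⊆ {x | (τ / 2 * B) ^ 2 ≤ G x ^ 2} := by
    intro x hx
    simp only [Set.mem_ofPred_eq] at hx ⊢
    have h := h5 N (shiftBy a x)
    have e : ∀ i : ℕ, shiftBy (i : ℤ) (shiftBy a x) = shiftBy (a + i) x := fun i => by
      rw [shiftBy_shiftBy, add_comm]
    simp only [e] at h
    have hGf : |G x - ((1 / (N : ℝ)) * ∑ i ∈ Finset.range N, f (shiftBy (a + i) x) - m)|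
        ≤ τ / 2 * B := by
      have e2 : G x - ((1 / (N : ℝ)) * ∑ i ∈ Finset.range N, f (shiftBy (a + i) x) - m)
          = (1 / (N : ℝ)) * (∑ i ∈ Finset.range N, F (shiftBy (a + i) x) -
            ∑ i ∈ Finset.range N, (f (shiftBy (a + i) x) - m)) := by
        simp only [G, Finset.sum_sub_distrib, Finset.sum_const, Finset.card_range, nsmul_eq_mul]
        field_simp
      rw [e2, abs_mul, abs_of_pos (by positivity)]
      calc _ ≤ (1 / (N : ℝ)) * (B * (2 ^ k * (L + k₀))) := by gcongr
        _ = B * (τ / 2) * ((2 / τ * 2 ^ k * (L + k₀)) / N) := by field_simp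
        _ ≤ B * (τ / 2) * 1 := by
            gcongr
            exact (div_le_one hN').2 hNL
        _ = _ := by ring
    rw [sq_le_sq, abs_of_pos (by positivity : 0 < τ / 2 * B)]
    have := abs_sub_abs_le_abs_sub
      ((1 / (N : ℝ)) * ∑ i ∈ Finset.range N, f (shiftBy (a + i) x) - m) (G x)
    rw [abs_sub_comm] at hGf
    linarith
  have hcheb := mul_meas_ge_le_integral_of_nonneg (ae_of_all P fun x => sq_nonneg (G x)) hGi
    ((τ / 2 * B) ^ 2)
  have hpos : 0 < (τ / 2 * B) ^ 2 := by positivity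
  calc _ ≤ P.real {x | (τ / 2 * B) ^ 2 ≤ G x ^ 2} := measureReal_mono hsub
    _ ≤ (ρ ^ k * B ^ 2) / (τ / 2 * B) ^ 2 := by
        rw [le_div_iff₀ hpos, mul_comm]; exact hcheb.trans hG2
    _ ≤ (η * (τ / 2) ^ 2 * B ^ 2) / (τ / 2 * B) ^ 2 := by gcongr
    _ = η := by field_simp

/-! ### Probabilities of words -/

section Words

variable {A : Type*} [Fintype A] [MeasurableSpace A] [MeasurableSingletonClass A]
  {k₀ : ℕ} {β δ : ℝ} {P : Measure (ℤ → A)}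

lemma cylinder_anti {A : Type*} (x : ℤ → A) {m n : ℕ} (h : m ≤ n) :
    cylinder x n ⊆ cylinder x m := fun _ hy i h1 h2 => hy i h1 (h2.trans (by exact_mod_cast h))

lemma cylinder_congr {A : Type*} {x x' : ℤ → A} {n : ℕ}
    (h : ∀ i ∈ Set.Icc 1 (n : ℤ), x i = x' i) : cylinder x n = cylinder x' n := by
  ext y
  refine forall_congr' fun i => forall₂_congr fun h1 h2 => ?_
  rw [h i ⟨h1, h2⟩]

lemma dependsOn_wordProb {A : Type*} [MeasurableSpace A] (P : Measure (ℤ → A)) (n : ℕ) :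
    DependsOn (fun x => wordProb P x n) (Set.Icc 1 (n : ℤ)) := fun x y h => by
  simp only [wordProb_eq, cylinder_congr h]

lemma cylinder_zero {A : Type*} (x : ℤ → A) : cylinder x 0 = Set.univ :=
  Set.eq_univ_of_forall fun y i h1 h2 => by
    have : i ≤ 0 := by simpa using h2
    omega

lemma wordProb_zero {A : Type*} [MeasurableSpace A] (P : Measure (ℤ → A)) [IsProbabilityMeasure P]
    (x : ℤ → A) : wordProb P x 0 = 1 := by
  rw [wordProb_eq, cylinder_zero, probReal_univ]

lemma wordProb_le_one {A : Type*} [MeasurableSpace A] (P : Measure (ℤ → A))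
    [IsProbabilityMeasure P] (x : ℤ → A) (n : ℕ) : wordProb P x n ≤ 1 :=
  measureReal_le_one

lemma RatioMixing.pow_le_wordProb {A : Type*} [MeasurableSpace A] {k₀ : ℕ} {β δ : ℝ}
    {P : Measure (ℤ → A)} (hP : RatioMixing k₀ β δ P) (hδ : 0 ≤ δ) (x : ℤ → A) (n : ℕ) :
    δ ^ n ≤ wordProb P x n := by
  have := hP.isProb
  induction n with
  | zero => rw [wordProb_zero, pow_zero]
  | succ n ih =>
    rw [pow_succ']
    exact (mul_le_mul_of_nonneg_left ih hδ).trans (hP.wordProb_succ x n)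

/-- With at least two letters, prolonging a word costs at least the factor `1 - δ`, since another
letter has conditional probability at least `δ`. -/
lemma RatioMixing.wordProb_succ_le [Nontrivial A] (hP : RatioMixing k₀ β δ P) (x : ℤ → A) (n : ℕ) :
    wordProb P x (n + 1) ≤ (1 - δ) * wordProb P x n := by
  classical
  have := hP.isProb
  obtain ⟨b, hb⟩ := exists_ne (x (n + 1))
  set x' : ℤ → A := Function.update x (n + 1) b with hx'
  have hc : cylinder x n = cylinder x' n := cylinder_congr fun i hi => by
    have : i ≠ (n : ℤ) + 1 := by have := hi.2; omega
    simp [hx', this]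
  have hdisj : Disjoint (cylinder x (n + 1)) (cylinder x' (n + 1)) := by
    rw [Set.disjoint_left]
    intro y h1 h2
    have e1 := h1 (n + 1) (by omega) (by push_cast; omega)
    have e2 := h2 (n + 1) (by omega) (by push_cast; omega)
    rw [e1] at e2
    simp [hx'] at e2
    exact hb e2.symm
  have hsub : cylinder x (n + 1) ∪ cylinder x' (n + 1) ⊆ cylinder x n :=
    Set.union_subset (cylinder_anti x n.le_succ) (hc ▸ cylinder_anti x' n.le_succ)
  have h := measureReal_mono (μ := P) hsub
  rw [measureReal_union hdisj (measurableSet_cylinder _ _)] at h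
  have h' := hP.wordProb_succ x' n
  simp only [wordProb_eq, ← hc] at h' ⊢
  linarith

lemma RatioMixing.wordProb_add_le [Nontrivial A] (hP : RatioMixing k₀ β δ P) (hδ : δ ≤ 1)
    (x : ℤ → A) (m n : ℕ) : wordProb P x (m + n) ≤ (1 - δ) ^ n * wordProb P x m := by
  induction n with
  | zero => simp
  | succ n ih =>
    calc wordProb P x (m + n + 1) ≤ (1 - δ) * wordProb P x (m + n) := hP.wordProb_succ_le _ _
      _ ≤ (1 - δ) * ((1 - δ) ^ n * wordProb P x m) := by
        apply mul_le_mul_of_nonneg_left ih; linarith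
      _ = _ := by ring

end Words

/-! ### Capped lengths -/

open Classical in
/-- The largest `j` with `1 ≤ j ≤ L` such that `p (j - 1)` holds, and `0` if there is none. -/
noncomputable def cappedLength (L : ℕ) (p : ℕ → Prop) : ℕ :=
  ((Finset.Icc 1 L).filter (fun j => p (j - 1))).sup id

section CappedLength

variable {L : ℕ} {p q : ℕ → Prop}

open Classical in
lemma cappedLength_le : cappedLength L p ≤ L :=
  Finset.sup_le fun _ hj => (Finset.mem_Icc.1 (Finset.mem_filter.1 hj).1).2

open Classical in
lemma succ_le_cappedLength {n : ℕ} (hn : n < L) (hp : p n) : n + 1 ≤ cappedLength L p :=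
  Finset.le_sup (f := id) (Finset.mem_filter.2 ⟨Finset.mem_Icc.2 ⟨by omega, hn⟩, by simpa using hp⟩)

open Classical in
lemma cappedLength_spec (h : 0 < cappedLength L p) : p (cappedLength L p - 1) := by
  have hne : ((Finset.Icc 1 L).filter (fun j => p (j - 1))).Nonempty := by
    by_contra hne
    rw [Finset.not_nonempty_iff_eq_empty] at hne
    rw [cappedLength, hne] at h
    exact absurd h (by simp)
  obtain ⟨j, hj, hj'⟩ := Finset.exists_mem_eq_sup _ hne id
  rw [cappedLength, hj']
  exact (Finset.mem_filter.1 hj).2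

lemma cappedLength_mono (h : ∀ n < L, p n → q n) : cappedLength L p ≤ cappedLength L q := by
  rcases Nat.eq_zero_or_pos (cappedLength L p) with h0 | h0
  · omega
  · have h1 : cappedLength L p ≤ L := cappedLength_le
    have := succ_le_cappedLength (L := L) (by omega) (h _ (by omega) (cappedLength_spec h0))
    omega

lemma cappedLength_congr (h : ∀ n < L, p n ↔ q n) : cappedLength L p = cappedLength L q :=
  le_antisymm (cappedLength_mono fun n hn => (h n hn).1) (cappedLength_mono fun n hn => (h n hn).2)

end CappedLength

section ThresholdLength

variable {A : Type*} [MeasurableSpace A]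

/-- The first `j` with `Q(x_1^j) < θ`, capped at `L`. -/
noncomputable def thresholdLength (L : ℕ) (θ : ℝ) (Q : Measure (ℤ → A)) (x : ℤ → A) : ℕ :=
  cappedLength L fun n => θ ≤ wordProb Q x n

lemma wordLength_eq (R ε₀ : ℝ) (N : ℕ) (Q : Measure (ℤ → A)) (x : ℤ → A) :
    wordLength R ε₀ N Q x = thresholdLength (Lmax R ε₀ N) (1 / (N : ℝ)) Q x := rfl

lemma thresholdLength_anti {L : ℕ} {θ θ' : ℝ} (h : θ ≤ θ') (Q : Measure (ℤ → A)) (x : ℤ → A) :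
    thresholdLength L θ' Q x ≤ thresholdLength L θ Q x :=
  cappedLength_mono fun _ _ h' => h.trans h'

lemma dependsOn_thresholdLength (L : ℕ) (θ : ℝ) (Q : Measure (ℤ → A)) :
    DependsOn (thresholdLength L θ Q) (Set.Icc 1 (L : ℤ)) := fun x y h =>
  cappedLength_congr fun n hn => by
    have e : wordProb Q x n = wordProb Q y n := dependsOn_wordProb Q n fun i hi =>
      h i ⟨hi.1, hi.2.trans (by exact_mod_cast hn.le)⟩
    rw [e]

variable [Fintype A] [MeasurableSingletonClass A] {k₀ : ℕ} {β δ : ℝ} {P : Measure (ℤ → A)}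

/-- Word probabilities decay exponentially, so that the length at which they fall below a threshold
depends on the threshold only logarithmically. -/
lemma RatioMixing.thresholdLength_le (hP : RatioMixing k₀ β δ P) (hδ₀ : 0 < δ) (hδ₁ : δ < 1)
    {θ θ' : ℝ} (hθ : 0 < θ) (hθθ' : θ ≤ θ') (hθ' : θ' ≤ 1) (L : ℕ) (x : ℤ → A) :
    (thresholdLength L θ P x : ℝ) ≤
      thresholdLength L θ' P x + (Real.log (θ' / θ) / (-Real.log (1 - δ)) + 1) := by
  have := hP.isProb
  have hlog : 0 < -Real.log (1 - δ) := by
    have := Real.log_neg (show 0 < 1 - δ by linarith) (by linarith)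
    linarith
  have hlog' : 0 ≤ Real.log (θ' / θ) := Real.log_nonneg ((one_le_div hθ).2 hθθ')
  have hq : 0 ≤ Real.log (θ' / θ) / (-Real.log (1 - δ)) := by positivity
  rcases le_or_gt (thresholdLength L θ P x) (thresholdLength L θ' P x) with h | h
  · have : (thresholdLength L θ P x : ℝ) ≤ thresholdLength L θ' P x := by exact_mod_cast h
    linarith
  set j := thresholdLength L θ P x with hj
  set j' := thresholdLength L θ' P x with hj'
  have hjL : j ≤ L := cappedLength_le
  have h1 : θ ≤ wordProb P x (j - 1) :=
    cappedLength_spec (p := fun n => θ ≤ wordProb P x n) (by change 0 < j; omega)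
  have h2 : wordProb P x j' < θ' := by
    by_contra hcon
    have : j' + 1 ≤ j' := succ_le_cappedLength (p := fun n => θ' ≤ wordProb P x n)
      (show j' < L by omega) (not_lt.1 hcon)
    omega
  rcases subsingleton_or_nontrivial A with hA | hA
  · -- over a single letter every word has probability one
    have : cylinder x j' = Set.univ := Set.eq_univ_of_forall fun y i _ _ => Subsingleton.elim _ _
    rw [wordProb_eq, this, probReal_univ] at h2
    linarith
  obtain ⟨m, hm⟩ : ∃ m, j - 1 = j' + m := ⟨j - 1 - j', by omega⟩
  have h3 : θ ≤ (1 - δ) ^ m * θ' := by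
    rw [hm] at h1
    exact (h1.trans (hP.wordProb_add_le hδ₁.le x j' m)).trans
      (mul_le_mul_of_nonneg_left h2.le (pow_nonneg (by linarith) _))
  have hθ'0 : 0 < θ' := hθ.trans_le hθθ'
  have h4 : Real.log θ ≤ m * Real.log (1 - δ) + Real.log θ' := by
    rw [← Real.log_pow, ← Real.log_mul (pow_pos (by linarith) _).ne' hθ'0.ne']
    exact Real.log_le_log hθ h3
  have h5 : (m : ℝ) ≤ Real.log (θ' / θ) / (-Real.log (1 - δ)) := by
    rw [le_div_iff₀ hlog, Real.log_div hθ'0.ne' hθ.ne']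
    linarith
  have h6 : (j : ℝ) = j' + m + 1 := by
    have : j = j' + m + 1 := by omega
    exact_mod_cast this
  rw [h6]; linarith

lemma RatioMixing.min_le_thresholdLength {A : Type*} [MeasurableSpace A] {k₀ : ℕ} {β δ : ℝ}
    {P : Measure (ℤ → A)} (hP : RatioMixing k₀ β δ P) (hδ₀ : 0 < δ) (hδ₁ : δ < 1)
    {N : ℕ} (hN : 0 < N) (L : ℕ) (x : ℤ → A) :
    min (L : ℝ) (Real.log N / (-Real.log δ)) ≤ thresholdLength L (1 / (N : ℝ)) P x := by
  have hlog : 0 < -Real.log δ := by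
    have := Real.log_neg hδ₀ hδ₁
    linarith
  have hN' : (0 : ℝ) < N := by exact_mod_cast hN
  set j := thresholdLength L (1 / (N : ℝ)) P x with hj
  rcases le_or_gt L j with h | h
  · exact (min_le_left _ _).trans (by exact_mod_cast h)
  refine (min_le_right _ _).trans ?_
  have h2 : wordProb P x j < 1 / N := by
    by_contra hcon
    have : j + 1 ≤ j := succ_le_cappedLength (p := fun n => 1 / (N : ℝ) ≤ wordProb P x n) h
      (not_lt.1 hcon)
    omega
  have h3 := (hP.pow_le_wordProb hδ₀.le x j).trans h2.le
  have h4 := Real.log_le_log (pow_pos hδ₀ _) h3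
  rw [Real.log_pow, Real.log_div one_ne_zero hN'.ne', Real.log_one] at h4
  rw [div_le_iff₀ hlog]
  linarith

end ThresholdLength

/-! ### Match lengths in terms of occurrences -/

section Match

variable {A : Type*}

/-- The word `x_1^n` occurs in one of the `K` training blocks of `y`. -/
def Occurs (K k₀ N : ℕ) (y x : ℤ → A) (n : ℕ) : Prop :=
  ∃ b < K, ∃ k < N, k + n ≤ N ∧ shiftBy ((b * (N + k₀) + k : ℕ) : ℤ) y ∈ cylinder x n

lemma recurrenceTime_le_iff (blocks : List (List A)) (z : List A) (N : ℕ) :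
    recurrenceTime blocks z ≤ (N : ℕ∞) ↔ ∃ k < N, ∃ b ∈ blocks, z <+: b.drop k := by
  constructor
  · intro h
    have hne : {t : ℕ∞ | ∃ k : ℕ, 1 ≤ k ∧ (∃ b ∈ blocks, z <+: b.drop (k - 1)) ∧ t = k}.Nonempty := by
      by_contra hne
      rw [Set.not_nonempty_iff_eq_empty] at hne
      rw [recurrenceTime, hne, sInf_empty] at h
      exact absurd h (by simp)
    obtain ⟨k, hk1, hb, hk⟩ := csInf_mem hne
    rw [recurrenceTime, hk] at h
    have : k ≤ N := by exact_mod_cast h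
    exact ⟨k - 1, by omega, hb⟩
  · rintro ⟨k, hk, hb⟩
    have : recurrenceTime blocks z ≤ ((k + 1 : ℕ) : ℕ∞) :=
      sInf_le ⟨k + 1, by omega, by simpa using hb, rfl⟩
    exact this.trans (by exact_mod_cast hk)

lemma length_suffix (K k₀ N : ℕ) (x : Fin (seqLength K k₀ N) → A) :
    (suffix K k₀ N x).length = N := by
  rw [suffix, List.length_drop, List.length_ofFn, seqLength, Nat.add_sub_cancel_left]

lemma matchLength_eq_cappedLength (R ε₀ : ℝ) (N : ℕ) (blocks : List (List A)) (w : List A) :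
    matchLength R ε₀ N blocks w = cappedLength (Lmax R ε₀ N) fun n =>
      n ≤ w.length ∧ recurrenceTime blocks (w.take n) ≤ (N : ℕ∞) := by
  unfold matchLength cappedLength
  congr!

lemma matchLength_eq (R ε₀ : ℝ) (K k₀ N : ℕ) (x y : ℤ → A) (i : ℕ) :
    matchLength R ε₀ N (trainingBlocks K k₀ N (segment _ y))
        ((suffix K k₀ N (segment _ x)).drop i) =
      cappedLength (Lmax R ε₀ N) fun n =>
        n ≤ N - i ∧ Occurs K k₀ N y (shiftBy ((K * (N + k₀) : ℕ) + i) x) n := by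
  rw [matchLength_eq_cappedLength]
  refine cappedLength_congr fun n _ => ?_
  rw [List.length_drop, length_suffix]
  refine and_congr_right fun hn => ?_
  rw [recurrenceTime_le_iff]
  constructor
  · rintro ⟨k, hk, b, hb, hz⟩
    simp only [trainingBlocks, List.mem_map, List.mem_range] at hb
    obtain ⟨b, hbK, rfl⟩ := hb
    have hlen := hz.length_le
    have hbN : (b + 1) * (N + k₀) ≤ K * (N + k₀) := Nat.mul_le_mul_right _ hbK
    rw [add_mul, one_mul] at hbN
    simp only [List.length_take, List.length_drop, length_suffix, List.length_ofFn] at hlen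
    rw [seqLength] at hlen
    refine ⟨b, hbK, k, hk, by omega, fun l h1 h2 => ?_⟩
    obtain ⟨l, rfl⟩ : ∃ m : ℕ, l = m + 1 := ⟨(l - 1).toNat, by omega⟩
    have hl : l < n := by omega
    have := (List.prefix_iff_getElem.1 hz).2 l (by
      simp only [List.length_take, List.length_drop, length_suffix]; omega)
    simp only [List.getElem_take, List.getElem_drop, suffix, List.getElem_ofFn, segment] at this
    simp only [shiftBy]
    convert this.symm using 2 <;> push_cast <;> ring
  · rintro ⟨b, hbK, k, hk, hkn, hy⟩
    have hbN : (b + 1) * (N + k₀) ≤ K * (N + k₀) := Nat.mul_le_mul_right _ hbK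
    rw [add_mul, one_mul] at hbN
    refine ⟨k, hk, _, List.mem_map.2 ⟨b, List.mem_range.2 hbK, rfl⟩, ?_⟩
    rw [List.prefix_iff_getElem]
    refine ⟨?_, fun l hl => ?_⟩
    · simp only [List.length_take, List.length_drop, length_suffix, List.length_ofFn]
      rw [seqLength]
      omega
    · have hl' : l < n := by
        simp only [List.length_take] at hl; omega
      have := hy (l + 1) (by omega) (by omega)
      simp only [List.getElem_take, List.getElem_drop, suffix, List.getElem_ofFn, segment]
      simp only [shiftBy] at this
      convert this.symm using 2 <;> push_cast <;> ring

/-- If every word of probability at least `θ'` occurs in the training data, while for few positions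
a word of probability less than `θ` does, then the mean match length is close to the average of the
lengths at which the word probabilities fall below `1 / N`. The term `L ^ 2 / N` is due to the
positions close to the end. -/
lemma abs_meanMatchLength_sub_le [MeasurableSpace A] (Q : Measure (ℤ → A)) (R ε₀ : ℝ)
    {K k₀ N : ℕ} (hN : 0 < N) (x y : ℤ → A) {θ θ' D κ : ℝ} (hθ : θ ≤ 1 / N) (hθ' : 1 / N ≤ θ')
    (hD : ∀ x, (thresholdLength (Lmax R ε₀ N) θ Q x : ℝ) ≤
      thresholdLength (Lmax R ε₀ N) θ' Q x + D)
    (hfull : ∀ x, ∀ n < Lmax R ε₀ N, θ' ≤ wordProb Q x n → Occurs K k₀ N y x n)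
    (hbad : ∑ i ∈ Finset.range N, Set.indicator {u | ∃ n < Lmax R ε₀ N, wordProb Q u n < θ ∧
      Occurs K k₀ N y u n} (fun _ => (1 : ℝ)) (shiftBy ((K * (N + k₀) : ℕ) + i) x) ≤ κ * N) :
    |meanMatchLength R ε₀ N (trainingBlocks K k₀ N (segment _ y)) (suffix K k₀ N (segment _ x))
      - (1 / (N : ℝ)) * ∑ i ∈ Finset.range N,
        (wordLength R ε₀ N Q (shiftBy ((K * (N + k₀) : ℕ) + i) x) : ℝ)| ≤
      D + κ * Lmax R ε₀ N + (Lmax R ε₀ N : ℝ) ^ 2 / N := by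
  classical
  set L := Lmax R ε₀ N with hL
  set bad : Set (ℤ → A) := {u | ∃ n < L, wordProb Q u n < θ ∧ Occurs K k₀ N y u n} with hbaddef
  set u : ℕ → ℤ → A := fun i => shiftBy ((K * (N + k₀) : ℕ) + i) x with hu
  have hN' : (0 : ℝ) < N := by exact_mod_cast hN
  have hD0 : 0 ≤ D := by
    have h1 := hD x
    have h2 : (thresholdLength L θ' Q x : ℝ) ≤ thresholdLength L θ Q x := by
      exact_mod_cast thresholdLength_anti (hθ.trans hθ') Q x
    linarith
  set m : ℕ → ℕ := fun i => cappedLength L fun n => n ≤ N - i ∧ Occurs K k₀ N y (u i) n with hm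
  set w : ℕ → ℕ := fun i => wordLength R ε₀ N Q (u i) with hw
  have hL0 : (0 : ℝ) ≤ L := by positivity
  have hmL : ∀ i, (m i : ℝ) ≤ L := fun i => by exact_mod_cast cappedLength_le
  have hwL : ∀ i, (w i : ℝ) ≤ L := fun i => by
    have : thresholdLength L (1 / (N : ℝ)) Q (u i) ≤ L := cappedLength_le
    exact_mod_cast this
  have hw1 : ∀ i, (w i : ℝ) ≤ thresholdLength L θ Q (u i) := fun i => by
    exact_mod_cast thresholdLength_anti hθ Q (u i)
  have hw2 : ∀ i, (thresholdLength L θ' Q (u i) : ℝ) ≤ w i := fun i => by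
    exact_mod_cast thresholdLength_anti hθ' Q (u i)
  have hup : ∀ i, (m i : ℝ) ≤ w i + D + L * bad.indicator (fun _ => (1 : ℝ)) (u i) := by
    intro i
    by_cases hb : u i ∈ bad
    · rw [Set.indicator_of_mem hb]
      have := hmL i
      have : (0 : ℝ) ≤ w i := by positivity
      linarith
    · rw [Set.indicator_of_notMem hb]
      have h1 : (m i : ℝ) ≤ thresholdLength L θ Q (u i) := by
        have : m i ≤ thresholdLength L θ Q (u i) := cappedLength_mono fun n hn hp => by
          by_contra hcon
          exact hb ⟨n, hn, not_le.1 hcon, hp.2⟩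
        exact_mod_cast this
      have := hD (u i)
      have := hw2 i
      linarith
  have hlow : ∀ i, (w i : ℝ) ≤ m i + D + L * (if N < i + L then 1 else 0) := by
    intro i
    split_ifs with hi
    · have := hwL i
      have : (0 : ℝ) ≤ m i := by positivity
      linarith
    · have h1 : (thresholdLength L θ' Q (u i) : ℝ) ≤ m i := by
        have : thresholdLength L θ' Q (u i) ≤ m i := cappedLength_mono fun n hn hp =>
          ⟨by omega, hfull _ n hn hp⟩
        exact_mod_cast this
      have := hD (u i)
      have := hw1 i
      linarith
  have hend : ∑ i ∈ Finset.range N, (if N < i + L then (1 : ℝ) else 0) ≤ L := by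
    rw [Finset.sum_boole]
    have hsub : (Finset.range N).filter (fun i => N < i + L) ⊆ Finset.Ico (N - L) N := by
      intro i hi
      simp only [Finset.mem_filter, Finset.mem_range, Finset.mem_Ico] at hi ⊢
      omega
    have := Finset.card_le_card hsub
    rw [Nat.card_Ico] at this
    have : ((Finset.range N).filter (fun i => N < i + L)).card ≤ L := by omega
    exact_mod_cast this
  have e : meanMatchLength R ε₀ N (trainingBlocks K k₀ N (segment _ y))
      (suffix K k₀ N (segment _ x)) = (1 / (N : ℝ)) * ∑ i ∈ Finset.range N, (m i : ℝ) := by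
    simp only [meanMatchLength, matchLength_eq, hm, hu, hL]
  have S1 : ∑ i ∈ Finset.range N, (m i : ℝ) ≤
      ∑ i ∈ Finset.range N, (w i : ℝ) + N * D + L * (κ * N) := by
    refine (Finset.sum_le_sum fun i _ => hup i).trans ?_
    rw [Finset.sum_add_distrib, Finset.sum_add_distrib, ← Finset.mul_sum]
    simp only [Finset.sum_const, Finset.card_range, nsmul_eq_mul]
    gcongr
  have S2 : ∑ i ∈ Finset.range N, (w i : ℝ) ≤
      ∑ i ∈ Finset.range N, (m i : ℝ) + N * D + L * L := by
    refine (Finset.sum_le_sum fun i _ => hlow i).trans ?_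
    rw [Finset.sum_add_distrib, Finset.sum_add_distrib, ← Finset.mul_sum]
    simp only [Finset.sum_const, Finset.card_range, nsmul_eq_mul]
    gcongr
  have hκ : 0 ≤ κ * N := le_trans
    (Finset.sum_nonneg fun i _ => Set.indicator_nonneg (fun _ _ => zero_le_one) _) hbad
  have hκ' : 0 ≤ κ := nonneg_of_mul_nonneg_left hκ hN'
  rw [e, ← mul_sub, abs_mul, abs_of_pos (by positivity : 0 < 1 / (N : ℝ))]
  have habs : |∑ i ∈ Finset.range N, (m i : ℝ) - ∑ i ∈ Finset.range N, (w i : ℝ)| ≤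
      N * D + L * (κ * N) + L * L := by
    have : 0 ≤ L * (κ * N) := by positivity
    have : 0 ≤ (L : ℝ) * L := by positivity
    rw [abs_le]; constructor <;> linarith
  calc _ ≤ 1 / (N : ℝ) * (N * D + L * (κ * N) + L * L) := by gcongr
    _ = _ := by field_simp

end Match

/-! ### Frequent words occur in the training data, rare words do not -/

section Occurrence

variable {A : Type*} {K k₀ N : ℕ}

lemma dependsOn_occurs_word (y : ℤ → A) (n : ℕ) :
    DependsOn (fun x => Occurs K k₀ N y x n) (Set.Icc 1 (n : ℤ)) := fun x x' h => by
  simp only [Occurs, cylinder_congr h]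

lemma dependsOn_occurs_training (x : ℤ → A) (n : ℕ) :
    DependsOn (fun y => Occurs K k₀ N y x n) (Set.Icc 1 ((K * (N + k₀) - k₀ : ℤ))) := by
  intro y z h
  refine propext (exists_congr fun b => and_congr_right fun hb => exists_congr fun k =>
    and_congr_right fun _ => and_congr_right fun hkn => iff_of_eq ?_)
  refine DependsOn.comp_shiftBy (dependsOn_mem_cylinder x n) _ (fun i hi => ?_) h
  have hbN : (b + 1) * (N + k₀) ≤ K * (N + k₀) := Nat.mul_le_mul_right _ hb
  zify at hbN hkn
  obtain ⟨h1, h2⟩ := hi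
  push_cast
  constructor
  · have : (0 : ℤ) ≤ b * (N + k₀) := by positivity
    omega
  · linarith

variable [MeasurableSpace A]

/-- The sequences starting with a word shorter than `L` which has probability less than `θ` and
nevertheless occurs in the training data of `y`. -/
def rareMatch (K k₀ N L : ℕ) (θ : ℝ) (Q : Measure (ℤ → A)) (y : ℤ → A) : Set (ℤ → A) :=
  {x | ∃ n < L, wordProb Q x n < θ ∧ Occurs K k₀ N y x n}

lemma dependsOn_rareMatch_word (L : ℕ) (θ : ℝ) (P : Measure (ℤ → A)) (y : ℤ → A) :
    DependsOn (fun x => x ∈ rareMatch K k₀ N L θ P y) (Set.Icc 1 (L : ℤ)) := by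
  intro x x' h
  refine propext (exists_congr fun n => and_congr_right fun hn => ?_)
  have h' : ∀ i ∈ Set.Icc 1 (n : ℤ), x i = x' i := fun i hi =>
    h i ⟨hi.1, hi.2.trans (by exact_mod_cast hn.le)⟩
  have e1 : wordProb P x n = wordProb P x' n := dependsOn_wordProb P n h'
  have e2 : Occurs K k₀ N y x n = Occurs K k₀ N y x' n := dependsOn_occurs_word y n h'
  rw [e1, e2]

lemma dependsOn_rareMatch_training (L : ℕ) (θ : ℝ) (P : Measure (ℤ → A)) (x : ℤ → A) :
    DependsOn (fun y => x ∈ rareMatch K k₀ N L θ P y) (Set.Icc 1 ((K * (N + k₀) - k₀ : ℤ))) := by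
  intro y z h
  refine propext (exists_congr fun n => and_congr_right fun _ => and_congr_right fun _ => ?_)
  exact iff_of_eq (dependsOn_occurs_training x n h)

variable [Fintype A] [MeasurableSingletonClass A]
  {β δ : ℝ} {P : Measure (ℤ → A)}

/-- A word of length at most `L` is searched for in `M` disjoint windows of the first block,
separated by gaps of `k₀` letters. By mixing, each window misses it with conditional probability at
most `1 - q / β`, where `q` is the probability of the word. -/
lemma RatioMixing.measureReal_not_occurs_le (hP : RatioMixing k₀ β δ P) (hβ : 1 ≤ β) (hK : 1 ≤ K)
    (hN : 0 < N) {L M n : ℕ} (hn : n ≤ L) (hM : M * (L + k₀) ≤ N) (x : ℤ → A) :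
    P.real {y | ¬ Occurs K k₀ N y x n} ≤ (1 - wordProb P x n / β) ^ M := by
  have := hP.isProb
  set q := wordProb P x n with hq
  have hβ0 : 0 < β := by linarith
  have hq1 : 0 ≤ 1 - q / β := by
    have : q / β ≤ 1 := by
      rw [div_le_one hβ0]; exact (wordProb_le_one P x n).trans hβ
    linarith
  let E : ℕ → Set (ℤ → A) := fun m =>
    {y | ∀ j < m, shiftBy ((j * (L + k₀) : ℕ) : ℤ) y ∉ cylinder x n}
  have hdep : ∀ m, DependsOn (fun y => y ∈ E m) (Set.Icc 1 ((m * (L + k₀) - k₀ : ℤ))) := by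
    intro m y z h
    refine propext (forall_congr' fun j => forall_congr' fun hj => not_congr (iff_of_eq ?_))
    refine DependsOn.comp_shiftBy (dependsOn_mem_cylinder x n) _ (fun i hi => ?_) h
    have hjm : (j + 1) * (L + k₀) ≤ m * (L + k₀) := Nat.mul_le_mul_right _ hj
    zify at hjm hn
    obtain ⟨h1, h2⟩ := hi
    push_cast
    constructor
    · have : (0 : ℤ) ≤ j * (L + k₀) := by positivity
      omega
    · linarith
  have hE : ∀ m, P.real (E m) ≤ (1 - q / β) ^ m := by
    intro m
    induction m with
    | zero => simp
    | succ m ih =>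
      set F : Set (ℤ → A) := {y | shiftBy ((m * (L + k₀) : ℕ) : ℤ) y ∈ cylinder x n} with hF
      have hFdep : DependsOn (fun y => y ∈ F)
          (Set.Icc (1 + ((m * (L + k₀) : ℕ) : ℤ)) (n + ((m * (L + k₀) : ℕ) : ℤ))) :=
        DependsOn.comp_shiftBy (dependsOn_mem_cylinder x n) _ fun i hi => by
          simp only [Set.mem_Icc] at *; omega
      have hFP : P.real F = q := hP.measureReal_shiftBy _ (measurableSet_cylinder x n)
      have hlow := hP.lower (m * (L + k₀) - k₀) (E m) F
        (coordSigma_mono (fun i hi => hi.2) _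
          (measurableSet_coordSigma_of_dependsOn (Set.finite_Icc _ _) (hdep m)))
        (coordSigma_mono (fun i hi => by
            simp only [Set.mem_Icc, Set.mem_ofPred_eq] at *; push_cast at hi; linarith [hi.1]) _
          (measurableSet_coordSigma_of_dependsOn (Set.finite_Icc _ _) hFdep))
      have hsucc : E (m + 1) = E m \ F := by
        ext y
        constructor
        · exact fun h => ⟨fun j hj => h j (by omega), h m (by omega)⟩
        · rintro ⟨h, h'⟩ j hj
          rcases Nat.lt_succ_iff_lt_or_eq.1 hj with hj | rfl
          · exact h j hj
          · exact h'
      have hFm : MeasurableSet F := measurableSet_of_dependsOn (Set.finite_Icc _ _) hFdep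
      have hadd := measureReal_inter_add_sdiff (μ := P) (s := E m) hFm
      rw [hFP] at hlow
      rw [hsucc, pow_succ']
      have : P.real (E m) * q / β ≤ P.real (E m ∩ F) := by
        rw [div_le_iff₀ hβ0]; linarith
      calc P.real (E m \ F) ≤ P.real (E m) - P.real (E m) * q / β := by linarith
        _ = (1 - q / β) * P.real (E m) := by ring
        _ ≤ _ := mul_le_mul_of_nonneg_left ih hq1
  refine (measureReal_mono fun y hy => ?_).trans (hE M)
  intro j hj hcon
  refine hy ⟨0, hK, j * (L + k₀), ?_, ?_, by simpa using hcon⟩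
  · rcases Nat.eq_zero_or_pos (L + k₀) with h0 | h0
    · rw [h0]; simpa using hN
    · exact lt_of_lt_of_le (Nat.mul_lt_mul_of_pos_right hj h0) hM
  · have h1 : (j + 1) * (L + k₀) ≤ M * (L + k₀) := Nat.mul_le_mul_right _ hj
    rw [add_mul, one_mul] at h1
    omega

/-- Except with small probability, all words shorter than `L` of probability at least `θ` occur in
the training data. -/
lemma RatioMixing.measureReal_exists_not_occurs_le (hP : RatioMixing k₀ β δ P) (hβ : 1 ≤ β)
    (hK : 1 ≤ K) (hN : 0 < N) {L M : ℕ} (hM : M * (L + k₀) ≤ N) {θ : ℝ} :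
    P.real {y | ∃ x, ∃ n < L, θ ≤ wordProb P x n ∧ ¬ Occurs K k₀ N y x n} ≤
      (Fintype.card A : ℝ) ^ L * L * Real.exp (-(M * (θ / β))) := by
  classical
  have := hP.isProb
  have hβ0 : 0 < β := by linarith
  obtain ⟨x₀⟩ : Nonempty (ℤ → A) := nonempty_of_isProbabilityMeasure P
  -- words are represented by sequences which agree with `x₀` outside `1, …, L`
  let e : (Fin L → A) → ℤ → A := fun u i =>
    if h : 1 ≤ i ∧ i ≤ L then u ⟨(i - 1).toNat, by omega⟩ else x₀ i
  let r : (Fin L → A) → ℕ → Set (ℤ → A) := fun u n =>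
    {y | θ ≤ wordProb P (e u) n ∧ ¬ Occurs K k₀ N y (e u) n}
  have hsub : {y | ∃ x, ∃ n < L, θ ≤ wordProb P x n ∧ ¬ Occurs K k₀ N y x n} ⊆
      ⋃ u : Fin L → A, ⋃ n ∈ Finset.range L, r u n := by
    rintro y ⟨x, n, hn, h1, h2⟩
    have hx : ∀ i ∈ Set.Icc 1 (n : ℤ), x i = e (fun j => x (j + 1)) i := by
      intro i hi
      have hi' : 1 ≤ i ∧ i ≤ L := ⟨hi.1, hi.2.trans (by exact_mod_cast hn.le)⟩
      simp only [e, dif_pos hi']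
      congr 1
      have := hi.1
      omega
    refine Set.mem_iUnion.2 ⟨fun j => x (j + 1), Set.mem_iUnion₂.2 ⟨n, Finset.mem_range.2 hn, ?_⟩⟩
    have e1 : wordProb P x n = wordProb P (e fun j => x (j + 1)) n := dependsOn_wordProb P n hx
    have e2 : Occurs K k₀ N y x n = Occurs K k₀ N y (e fun j => x (j + 1)) n :=
      dependsOn_occurs_word y n hx
    exact ⟨e1 ▸ h1, (iff_of_eq (congrArg Not e2)).1 h2⟩
  have hr : ∀ u, ∀ n ∈ Finset.range L, P.real (r u n) ≤ Real.exp (-(M * (θ / β))) := by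
    intro u n hn
    by_cases hθ : θ ≤ wordProb P (e u) n
    · have h1 := hP.measureReal_not_occurs_le hβ hK hN (Finset.mem_range.1 hn).le hM (e u)
      have hsub' : r u n ⊆ {y | ¬ Occurs K k₀ N y (e u) n} := fun y hy => hy.2
      refine (measureReal_mono hsub').trans (h1.trans ?_)
      have hq : wordProb P (e u) n / β ≤ 1 := by
        rw [div_le_one hβ0]; exact (wordProb_le_one P _ n).trans hβ
      calc (1 - wordProb P (e u) n / β) ^ M ≤ Real.exp (-(wordProb P (e u) n / β)) ^ M := by
            refine pow_le_pow_left₀ (by linarith) ?_ M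
            have := Real.add_one_le_exp (-(wordProb P (e u) n / β))
            linarith
        _ = Real.exp (-(M * (wordProb P (e u) n / β))) := by
            rw [← Real.exp_nat_mul]; ring_nf
        _ ≤ _ := by gcongr
    · have : r u n = ∅ := Set.eq_empty_of_forall_notMem fun y hy => hθ hy.1
      rw [this, measureReal_empty]
      positivity
  calc _ ≤ P.real (⋃ u : Fin L → A, ⋃ n ∈ Finset.range L, r u n) := measureReal_mono hsub
    _ ≤ ∑ u : Fin L → A, P.real (⋃ n ∈ Finset.range L, r u n) := measureReal_iUnion_fintype_le _
    _ ≤ ∑ u : Fin L → A, ∑ n ∈ Finset.range L, P.real (r u n) :=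
        Finset.sum_le_sum fun u _ => measureReal_biUnion_finset_le _ _
    _ ≤ ∑ _u : Fin L → A, ∑ _n ∈ Finset.range L, Real.exp (-(M * (θ / β))) :=
        Finset.sum_le_sum fun u _ => Finset.sum_le_sum (hr u)
    _ = _ := by simp [mul_assoc]

/-- The first moment bound for rare words: there are `K * N` places where a given word may occur. -/
lemma RatioMixing.measureReal_rareMatch_le (hP : RatioMixing k₀ β δ P) (L : ℕ) {θ : ℝ}
    (hθ : 0 ≤ θ) (x : ℤ → A) :
    P.real {y | x ∈ rareMatch K k₀ N L θ P y} ≤ L * (K * (N * θ)) := by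
  classical
  have := hP.isProb
  let S : Finset ℕ := (Finset.range L).filter fun n => wordProb P x n < θ
  have hsub : {y | x ∈ rareMatch K k₀ N L θ P y} ⊆ ⋃ n ∈ S, ⋃ b ∈ Finset.range K,
      ⋃ k ∈ Finset.range N, shiftBy ((b * (N + k₀) + k : ℕ) : ℤ) ⁻¹' cylinder x n := by
    rintro y ⟨n, hn, hθ, b, hb, k, hk, -, h⟩
    simp only [Set.mem_iUnion]
    exact ⟨n, Finset.mem_filter.2 ⟨Finset.mem_range.2 hn, hθ⟩, b, Finset.mem_range.2 hb, k,
      Finset.mem_range.2 hk, h⟩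
  have hcard : (S.card : ℝ) ≤ L := by
    have := Finset.card_filter_le (Finset.range L) fun n => wordProb P x n < θ
    rw [Finset.card_range] at this
    exact_mod_cast this
  calc _ ≤ P.real (⋃ n ∈ S, ⋃ b ∈ Finset.range K, ⋃ k ∈ Finset.range N,
        shiftBy ((b * (N + k₀) + k : ℕ) : ℤ) ⁻¹' cylinder x n) := measureReal_mono hsub (measure_ne_top P _)
    _ ≤ ∑ n ∈ S, ∑ b ∈ Finset.range K, ∑ k ∈ Finset.range N,
        P.real (shiftBy ((b * (N + k₀) + k : ℕ) : ℤ) ⁻¹' cylinder x n) :=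
      (measureReal_biUnion_finset_le _ _).trans (Finset.sum_le_sum fun n _ =>
        (measureReal_biUnion_finset_le _ _).trans (Finset.sum_le_sum fun b _ =>
          measureReal_biUnion_finset_le _ _))
    _ ≤ ∑ n ∈ S, ∑ b ∈ Finset.range K, ∑ k ∈ Finset.range N, θ :=
      Finset.sum_le_sum fun n hn => Finset.sum_le_sum fun b _ => Finset.sum_le_sum fun k _ => by
        rw [hP.measureReal_shiftBy _ (measurableSet_cylinder x n)]
        exact (Finset.mem_filter.1 hn).2.le
    _ = S.card * (K * (N * θ)) := by simp
    _ ≤ L * (K * (N * θ)) := by gcongr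

end Occurrence

/-- Markov's inequality for the number of events that happen. -/
lemma measureReal_lt_sum_indicator_le {Ω : Type*} [MeasurableSpace Ω] {μ : Measure Ω}
    [IsProbabilityMeasure μ] {B : ℕ → Set Ω} (hB : ∀ i, MeasurableSet (B i)) {N : ℕ} (hN : 0 < N)
    {c κ : ℝ} (hκ : 0 < κ) (hc : ∀ i, μ.real (B i) ≤ c) :
    μ.real {ω | κ * N < ∑ i ∈ Finset.range N, (B i).indicator (fun _ => (1 : ℝ)) ω} ≤ c / κ := by
  have hN' : (0 : ℝ) < N := by exact_mod_cast hN
  have hi : ∀ i, Integrable ((B i).indicator fun _ => (1 : ℝ)) μ := fun i =>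
    (integrable_const 1).indicator (hB i)
  have hint : Integrable (fun ω => ∑ i ∈ Finset.range N, (B i).indicator (fun _ => (1 : ℝ)) ω) μ :=
    integrable_finsetSum _ fun i _ => hi i
  have h := mul_meas_ge_le_integral_of_nonneg (ae_of_all μ fun ω => Finset.sum_nonneg
    fun i (_ : i ∈ Finset.range N) => Set.indicator_nonneg (s := B i) (f := fun _ => (1 : ℝ))
      (fun _ _ => zero_le_one) ω) hint (κ * N)
  rw [integral_finsetSum _ fun i _ => hi i] at h
  have h2 : ∑ i ∈ Finset.range N, ∫ ω, (B i).indicator (fun _ => (1 : ℝ)) ω ∂μ ≤ N * c := by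
    calc _ ≤ ∑ i ∈ Finset.range N, c := Finset.sum_le_sum fun i _ => by
          rw [integral_indicator_const _ (hB i)]; simpa using hc i
      _ = N * c := by simp
  have hmono : μ.real {ω | κ * N < ∑ i ∈ Finset.range N, (B i).indicator (fun _ => (1 : ℝ)) ω} ≤
      μ.real {ω | κ * N ≤ ∑ i ∈ Finset.range N, (B i).indicator (fun _ => (1 : ℝ)) ω} :=
    measureReal_mono (fun ω hω => by simp only [Set.mem_ofPred_eq] at *; exact hω.le) (measure_ne_top μ _)
  refine hmono.trans ?_
  rw [le_div_iff₀ hκ]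
  have h3 := h.trans h2
  have : N * (κ * μ.real {ω | κ * N ≤ ∑ i ∈ Finset.range N,
      (B i).indicator (fun _ => (1 : ℝ)) ω}) ≤ N * c := by
    refine le_trans (le_of_eq ?_) h3
    ring
  linarith [le_of_mul_le_mul_left this hN']

/-! ### Mean match lengths -/

section MeanMatch

variable {A : Type*} [Fintype A] [MeasurableSpace A] [MeasurableSingletonClass A]
  {K k₀ N : ℕ} {β δ : ℝ} {P Q : Measure (ℤ → A)}

lemma measureReal_preimage_le {Ω Ω' : Type*} [MeasurableSpace Ω] [MeasurableSpace Ω']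
    {μ : Measure Ω} {ν : Measure Ω'} [IsFiniteMeasure ν] {f : Ω → Ω'}
    (hf : MeasurePreserving f μ ν) (s : Set Ω') : μ.real (f ⁻¹' s) ≤ ν.real s := by
  have h : μ (f ⁻¹' s) ≤ ν s := by
    rw [← hf.map_eq]; exact Measure.le_map_apply hf.measurable.aemeasurable s
  exact ENNReal.toReal_mono (measure_ne_top ν s) h

lemma measurableSet_rareMatch (L : ℕ) (θ : ℝ) (a : ℤ) :
    MeasurableSet {ω : (ℤ → A) × (ℤ → A) |
      shiftBy a ω.1 ∈ rareMatch K k₀ N L θ Q ω.2} :=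
  measurableSet_prod_of_dependsOn (S := Set.Icc (1 + a) (L + a)) (Set.finite_Icc _ _)
    (Set.finite_Icc _ _) (r := fun x y => shiftBy a x ∈ rareMatch K k₀ N L θ Q y)
    (fun y => DependsOn.comp_shiftBy (dependsOn_rareMatch_word L θ _ y) a fun i hi => by
      simp only [Set.mem_Icc] at *; omega)
    (fun x => dependsOn_rareMatch_training L θ _ (shiftBy a x))

/-- Rare matches when training and test data are independent. -/
lemma RatioMixing.measureReal_prod_rareMatch_le [IsProbabilityMeasure P]
    (hQ : RatioMixing k₀ β δ Q) (L : ℕ) {θ : ℝ} (hθ : 0 ≤ θ) (a : ℤ) :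
    (P.prod Q).real {ω | shiftBy a ω.1 ∈ rareMatch K k₀ N L θ Q ω.2} ≤ L * (K * (N * θ)) := by
  have := hQ.isProb
  have hpos : 0 ≤ (L : ℝ) * (K * (N * θ)) := by positivity
  rw [measureReal_def, Measure.prod_apply (measurableSet_rareMatch L θ a)]
  refine ENNReal.toReal_le_of_le_ofReal hpos ?_
  calc _ ≤ ∫⁻ _x, ENNReal.ofReal (L * (K * (N * θ))) ∂P := by
        refine lintegral_mono fun x => ?_
        rw [← ofReal_measureReal]
        exact ENNReal.ofReal_le_ofReal (hQ.measureReal_rareMatch_le L hθ (shiftBy a x))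
    _ = _ := by simp

/-- Rare matches when training and test data belong to one sequence: the guard space between them
makes up for the dependence, at the cost of the factor `β`. -/
lemma RatioMixing.measureReal_self_rareMatch_le (hP : RatioMixing k₀ β δ P) (hβ : 0 ≤ β) (L : ℕ)
    {θ : ℝ} (hθ : 0 ≤ θ) (i : ℕ) :
    P.real {x | shiftBy ((K * (N + k₀) : ℕ) + i) x ∈ rareMatch K k₀ N L θ P x} ≤
      β * (L * (K * (N * θ))) := by
  refine hP.measureReal_le_of_forall hβ (Set.finite_Icc 1 ((K * (N + k₀) - k₀ : ℤ)))
    (Set.finite_Icc (1 + ((K * (N + k₀) : ℕ) + i : ℤ)) (L + ((K * (N + k₀) : ℕ) + i : ℤ)))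
    (a := (K * (N + k₀) - k₀ : ℤ)) (fun j hj => hj.2) (fun j hj => ?_)
    (r := fun y x => shiftBy ((K * (N + k₀) : ℕ) + i) x ∈ rareMatch K k₀ N L θ P y)
    (fun x => dependsOn_rareMatch_training L θ _ _)
    (fun y => DependsOn.comp_shiftBy (dependsOn_rareMatch_word L θ _ y) _ fun j hj => ?_)
    (fun x => hP.measureReal_rareMatch_le L hθ _)
  · simp only [Set.mem_Icc] at hj
    push_cast at hj
    have : (0 : ℤ) ≤ i := by positivity
    linarith [hj.1]
  · simp only [Set.mem_Icc] at *; omega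

/-- The error probability of the mean match length, for test data `X` and training data `Y` defined
on a common probability space, is bounded by that of three events: a frequent word is missing in the
training data; the average along `X` of the lengths `L_N(· | Q)` is far from its mean; rare words
occur too often. -/
lemma measureReal_meanMatchLength_le {Ω : Type*} [MeasurableSpace Ω] {μ : Measure Ω}
    [IsProbabilityMeasure μ] {X Y : Ω → ℤ → A} (hX : MeasurePreserving X μ P)
    (hY : MeasurePreserving Y μ Q) [IsProbabilityMeasure P] (hQ : RatioMixing k₀ β δ Q)
    (hβ : 1 ≤ β) (hδ₀ : 0 < δ) (hδ₁ : δ < 1)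
    (hK : 1 ≤ K) (hN : 0 < N) (R ε₀ : ℝ) {θ θ' κ c s : ℝ} (hθ0 : 0 < θ) (hθ : θ ≤ 1 / N)
    (hθ' : 1 / N ≤ θ') (hθ'1 : θ' ≤ 1) (hκ : 0 < κ)
    (hc : ∀ i : ℕ, μ.real {ω | shiftBy ((K * (N + k₀) : ℕ) + i) (X ω) ∈
      rareMatch K k₀ N (Lmax R ε₀ N) θ Q (Y ω)} ≤ c)
    {M : ℕ} (hM : M * (Lmax R ε₀ N + k₀) ≤ N) {p : ℝ}
    (hp : P.real {x | s ≤ |(1 / (N : ℝ)) * ∑ i ∈ Finset.range N,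
      (wordLength R ε₀ N Q (shiftBy ((K * (N + k₀) : ℕ) + i) x) : ℝ) -
        meanLength R ε₀ N P Q|} ≤ p) {t : ℝ}
    (ht : Real.log (θ' / θ) / (-Real.log (1 - δ)) + 1 + κ * Lmax R ε₀ N +
      (Lmax R ε₀ N : ℝ) ^ 2 / N + s ≤ t) :
    μ.real {ω | t ≤ |meanMatchLength R ε₀ N (trainingBlocks K k₀ N (segment _ (Y ω)))
      (suffix K k₀ N (segment _ (X ω))) - meanLength R ε₀ N P Q|} ≤
      (Fintype.card A : ℝ) ^ (Lmax R ε₀ N) * Lmax R ε₀ N * Real.exp (-(M * (θ' / β))) +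
        p + c / κ := by
  have := hQ.isProb
  set L := Lmax R ε₀ N with hL
  set a : ℤ := ((K * (N + k₀) : ℕ) : ℤ) with ha
  set E₁ : Set (ℤ → A) := {y | ∃ x, ∃ n < L, θ' ≤ wordProb Q x n ∧ ¬ Occurs K k₀ N y x n} with hE₁
  set E₂ : Set (ℤ → A) := {x | s ≤ |(1 / (N : ℝ)) * ∑ i ∈ Finset.range N,
      (wordLength R ε₀ N Q (shiftBy (a + i) x) : ℝ) - meanLength R ε₀ N P Q|} with hE₂
  set B : ℕ → Set Ω := fun i => {ω | shiftBy (a + i) (X ω) ∈ rareMatch K k₀ N L θ Q (Y ω)} with hB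
  set E₃ : Set Ω := {ω | κ * N < ∑ i ∈ Finset.range N, (B i).indicator (fun _ => (1 : ℝ)) ω}
    with hE₃
  have hBm : ∀ i, MeasurableSet (B i) := fun i =>
    (hX.measurable.prodMk hY.measurable) (measurableSet_rareMatch L θ (a + i))
  have hsub : {ω | t ≤ |meanMatchLength R ε₀ N (trainingBlocks K k₀ N (segment _ (Y ω)))
      (suffix K k₀ N (segment _ (X ω))) - meanLength R ε₀ N P Q|} ⊆ Y ⁻¹' E₁ ∪ X ⁻¹' E₂ ∪ E₃ := by
    intro ω hω
    by_contra hcon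
    simp only [Set.mem_union, not_or] at hcon
    obtain ⟨⟨h1, h2⟩, h3⟩ := hcon
    have hfull : ∀ x, ∀ n < L, θ' ≤ wordProb Q x n → Occurs K k₀ N (Y ω) x n := by
      intro x n hn hx
      by_contra hno
      exact h1 ⟨x, n, hn, hx, hno⟩
    have h2' : |(1 / (N : ℝ)) * ∑ i ∈ Finset.range N,
      (wordLength R ε₀ N Q (shiftBy (a + i) (X ω)) : ℝ) - meanLength R ε₀ N P Q| < s :=
      not_le.1 h2
    have h3' : ∑ i ∈ Finset.range N, (B i).indicator (fun _ => (1 : ℝ)) ω ≤ κ * N := not_lt.1 h3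
    have key := abs_meanMatchLength_sub_le Q R ε₀ hN (X ω) (Y ω) hθ hθ'
      (fun x => hQ.thresholdLength_le hδ₀ hδ₁ hθ0 (hθ.trans hθ') hθ'1 L x) hfull
      (κ := κ) h3'
    have htri := abs_sub_le (meanMatchLength R ε₀ N (trainingBlocks K k₀ N (segment _ (Y ω)))
      (suffix K k₀ N (segment _ (X ω)))) ((1 / (N : ℝ)) * ∑ i ∈ Finset.range N,
      (wordLength R ε₀ N Q (shiftBy (a + i) (X ω)) : ℝ)) (meanLength R ε₀ N P Q)
    have hω' : t ≤ _ := hω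
    linarith
  calc _ ≤ μ.real (Y ⁻¹' E₁ ∪ X ⁻¹' E₂ ∪ E₃) := measureReal_mono hsub
    _ ≤ μ.real (Y ⁻¹' E₁) + μ.real (X ⁻¹' E₂) + μ.real E₃ :=
      (measureReal_union_le _ _).trans (by gcongr; exact measureReal_union_le _ _)
    _ ≤ _ := by
      gcongr
      · exact (measureReal_preimage_le hY _).trans
          (hQ.measureReal_exists_not_occurs_le hβ hK hN hM)
      · exact (measureReal_preimage_le hX _).trans hp
      · exact measureReal_lt_sum_indicator_le hBm hN hκ hc

end MeanMatch

/-! ### Large `N` -/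

lemma eventually_log_ge (c : ℝ) : ∀ᶠ N : ℕ in atTop, c ≤ Real.log N :=
  (Real.tendsto_log_atTop.comp tendsto_natCast_atTop_atTop).eventually_ge_atTop c

lemma eventually_log_rpow_le (r : ℝ) {s c : ℝ} (hs : 0 < s) (hc : 0 < c) :
    ∀ᶠ N : ℕ in atTop, Real.log N ^ r ≤ c * (N : ℝ) ^ s := by
  have h := ((isLittleO_log_rpow_rpow_atTop r hs).def hc).filter_mono le_rfl
  have h' := (tendsto_natCast_atTop_atTop (R := ℝ)).eventually h
  filter_upwards [h', eventually_log_ge 0] with N hN h0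
  rw [Real.norm_of_nonneg (Real.rpow_nonneg h0 _), Real.norm_of_nonneg (by positivity)] at hN
  exact hN

section Lmax

variable {R ε₀ : ℝ}

lemma Lmax_le (h : 0 < R + ε₀) {N : ℕ} (hN : 1 ≤ N) :
    (Lmax R ε₀ N : ℝ) ≤ 1 / ((R + ε₀) * Real.log 2) * Real.log N := by
  have h2 : 0 < Real.log 2 := Real.log_pos one_lt_two
  have hl : 0 ≤ Real.log N := Real.log_nonneg (by exact_mod_cast hN)
  refine (Nat.floor_le ?_).trans (le_of_eq ?_)
  · rw [Real.logb]; positivity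
  · rw [Real.logb]; field_simp

lemma eventually_le_Lmax (h : 0 < R + ε₀) :
    ∀ᶠ N : ℕ in atTop, 1 / (2 * ((R + ε₀) * Real.log 2)) * Real.log N ≤ Lmax R ε₀ N := by
  have h2 : 0 < Real.log 2 := Real.log_pos one_lt_two
  have hC : 0 < 1 / (2 * ((R + ε₀) * Real.log 2)) := by positivity
  filter_upwards [eventually_log_ge (1 / (1 / (2 * ((R + ε₀) * Real.log 2))))] with N hN
  rw [div_le_iff₀ hC] at hN
  have h1 := Nat.lt_floor_add_one (Real.logb 2 N / (R + ε₀))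
  have e : Real.logb 2 N / (R + ε₀) = 2 * (1 / (2 * ((R + ε₀) * Real.log 2)) * Real.log N) := by
    rw [Real.logb]; field_simp
  change _ < (Lmax R ε₀ N : ℝ) + 1 at h1
  rw [e] at h1
  linarith

lemma eventually_Lmax_le_self (h : 0 < R + ε₀) : ∀ᶠ N : ℕ in atTop, Lmax R ε₀ N ≤ N := by
  have h2 : 0 < Real.log 2 := Real.log_pos one_lt_two
  have hC : 0 < (R + ε₀) * Real.log 2 := by positivity
  filter_upwards [eventually_log_rpow_le 1 one_pos hC, eventually_ge_atTop 1] with N hN h1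
  rw [Real.rpow_one, Real.rpow_one] at hN
  have : (Lmax R ε₀ N : ℝ) ≤ N := by
    refine (Lmax_le h h1).trans ?_
    rw [div_mul_eq_mul_div, one_mul, div_le_iff₀ hC]
    linarith
  exact_mod_cast this

end Lmax

/-- The expected number of frequent words which are missing in the training data tends to `0`: there
are polynomially many words, and each is missing with probability at most
`exp (-N ^ κ / polylog)`. -/
lemma eventually_missing_words_le (c k₀ : ℕ) (hc : 1 ≤ c) {C₁ β κ η : ℝ} (hC₁ : 0 < C₁)
    (hβ : 1 ≤ β) (hκ : 0 < κ) (hκ1 : κ ≤ 1) (hη : 0 < η) :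
    ∀ᶠ N : ℕ in atTop, ∀ L : ℕ, (L : ℝ) ≤ C₁ * Real.log N → ∃ M : ℕ, M * (L + k₀) ≤ N ∧
      (c : ℝ) ^ L * L * Real.exp (-(M * ((N : ℝ) ^ (-1 + κ) / β))) ≤ η := by
  have hc0 : (0 : ℝ) < c := by exact_mod_cast hc
  have hlogc : 0 ≤ Real.log c := Real.log_nonneg (by exact_mod_cast hc)
  set C' := C₁ * Real.log c + 2 with hC'
  set C₃ := C₁ + 1 with hC₃
  have hC'0 : 0 < C' := by positivity
  have hC₃0 : 0 < C₃ := by positivity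
  have hβ0 : 0 < β := by linarith
  have hc1 : 0 < 1 / (β * C₃ * (C' + 1)) := by positivity
  filter_upwards [eventually_log_rpow_le 2 hκ hc1, eventually_log_ge k₀, eventually_log_ge 1,
    eventually_ge_atTop 1, eventually_log_rpow_le 1 one_pos (show 0 < η / C₁ by positivity)]
    with N hN2 hk hl1 hN1 hNη L hL
  have hN0 : (0 : ℝ) < N := by exact_mod_cast hN1
  set l := Real.log N with hl
  have hl0 : 0 < l := by linarith
  rw [Real.rpow_one, Real.rpow_one] at hNη
  rw [Real.rpow_two] at hN2
  have hden : 0 < C₃ * l := by positivity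
  refine ⟨⌊(N : ℝ) / (C₃ * l)⌋₊, ?_, ?_⟩
  · have h1 : (⌊(N : ℝ) / (C₃ * l)⌋₊ : ℝ) ≤ N / (C₃ * l) := Nat.floor_le (by positivity)
    have h2 : (L : ℝ) + k₀ ≤ C₃ * l := by rw [hC₃]; linarith
    have : (⌊(N : ℝ) / (C₃ * l)⌋₊ : ℝ) * (L + k₀) ≤ N := by
      calc _ ≤ N / (C₃ * l) * (C₃ * l) := by gcongr
        _ = N := by field_simp
    exact_mod_cast this
  · set M := ⌊(N : ℝ) / (C₃ * l)⌋₊ with hM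
    have hM1 : (N : ℝ) / (C₃ * l) - 1 ≤ M := by
      have := Nat.lt_floor_add_one ((N : ℝ) / (C₃ * l))
      linarith
    have hpow : (N : ℝ) ^ (-1 + κ) = N ^ κ / N := by
      rw [Real.rpow_add hN0, Real.rpow_neg_one]; field_simp
    have hpow1 : (N : ℝ) ^ κ / N ≤ 1 := by
      rw [div_le_one hN0]
      calc (N : ℝ) ^ κ ≤ N ^ (1 : ℝ) := Real.rpow_le_rpow_of_exponent_le (by exact_mod_cast hN1) hκ1
        _ = N := Real.rpow_one _
    have hpow0 : 0 ≤ (N : ℝ) ^ κ / N := by positivity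
    have key : C' * l ≤ M * ((N : ℝ) ^ (-1 + κ) / β) := by
      rw [hpow]
      have h3 : β * C₃ * (C' + 1) * l ^ 2 ≤ (N : ℝ) ^ κ := by
        have := mul_le_mul_of_nonneg_left hN2 (show 0 ≤ β * C₃ * (C' + 1) by positivity)
        calc _ ≤ _ := this
          _ = _ := by field_simp
      calc C' * l ≤ (C' + 1) * l - 1 / β := by
            have : 1 / β ≤ 1 := by rw [div_le_one hβ0]; exact hβ
            linarith
        _ = (β * C₃ * (C' + 1) * l ^ 2) / (β * C₃ * l) - 1 / β := by field_simp
        _ ≤ (N : ℝ) ^ κ / (β * C₃ * l) - (N ^ κ / N) / β := by gcongr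
        _ = ((N : ℝ) / (C₃ * l) - 1) * (N ^ κ / N / β) := by field_simp
        _ ≤ M * (N ^ κ / N / β) := by gcongr
    have h4 : (c : ℝ) ^ L ≤ Real.exp (C₁ * Real.log c * l) := by
      rw [← Real.exp_log (pow_pos hc0 L), Real.log_pow]
      apply Real.exp_le_exp.2
      calc (L : ℝ) * Real.log c ≤ C₁ * l * Real.log c := by gcongr
        _ = _ := by ring
    have h5 : Real.exp (-l) = 1 / N := by rw [Real.exp_neg, Real.exp_log hN0, one_div]
    calc (c : ℝ) ^ L * L * Real.exp (-(M * ((N : ℝ) ^ (-1 + κ) / β)))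
        ≤ Real.exp (C₁ * Real.log c * l) * (C₁ * l) * Real.exp (-(C' * l)) := by gcongr
      _ = C₁ * l * Real.exp (C₁ * Real.log c * l + -(C' * l)) := by rw [Real.exp_add]; ring
      _ = C₁ * l * (Real.exp (-l) * Real.exp (-l)) := by
          rw [← Real.exp_add, hC']; ring_nf
      _ ≤ C₁ * (η / C₁ * N) * (1 / N * 1) := by
          rw [h5]
          have : (1 : ℝ) / N ≤ 1 := by
            rw [div_le_one hN0]; exact_mod_cast hN1
          gcongr
      _ = η := by field_simp

section Uniform

variable {A : Type*} [Fintype A] [MeasurableSpace A] [MeasurableSingletonClass A]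

/-- Uniformly over all pairs of sources with the given mixing constant, the mean match lengths are
close to the mean lengths in the divergence, both for independent training and test data and for
training and test data from one sequence. -/
theorem exists_meanMatchLength_close (k₀ K : ℕ) (hK : 1 ≤ K) {δ R ε₀ β : ℝ} (hδ₀ : 0 < δ)
    (hδ₁ : δ < 1) (hR : 0 < R + ε₀) (hβ : 1 ≤ β) {ε η : ℝ} (hε : 0 < ε) (hη : 0 < η) :
    ∀ᶠ N : ℕ in atTop, ∀ P Q : Measure (ℤ → A), RatioMixing k₀ β δ P → RatioMixing k₀ β δ Q →
      (P.prod Q).real {ω | ε * Real.log N ≤ |meanMatchLength R ε₀ N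
        (trainingBlocks K k₀ N (segment _ ω.2)) (suffix K k₀ N (segment _ ω.1)) -
          meanLength R ε₀ N P Q|} ≤ η ∧
      P.real {x | ε * Real.log N ≤ |meanMatchLength R ε₀ N
        (trainingBlocks K k₀ N (segment _ x)) (suffix K k₀ N (segment _ x)) -
          meanLength R ε₀ N P P|} ≤ η := by
  have hlog2 : 0 < Real.log 2 := Real.log_pos one_lt_two
  have hlogδ : 0 < -Real.log (1 - δ) := by
    have := Real.log_neg (show 0 < 1 - δ by linarith) (by linarith)
    linarith
  set C₁ := 1 / ((R + ε₀) * Real.log 2) with hC₁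
  set C₂ := 1 / (-Real.log (1 - δ)) with hC₂
  have hC₁0 : 0 < C₁ := by positivity
  have hC₂0 : 0 < C₂ := by positivity
  -- `κ` is chosen such that the main part of the error is at most `ε / 2 * log N`
  set κ := min 1 (ε / (2 * (2 * C₂ + 2 * C₁))) with hκdef
  have hκ0 : 0 < κ := lt_min one_pos (by positivity)
  have hκ1 : κ ≤ 1 := min_le_left _ _
  have hκε : κ * (2 * C₂ + 2 * C₁) ≤ ε / 2 := by
    have : κ ≤ ε / (2 * (2 * C₂ + 2 * C₁)) := min_le_right _ _
    calc _ ≤ ε / (2 * (2 * C₂ + 2 * C₁)) * (2 * C₂ + 2 * C₁) := by gcongr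
      _ = ε / 2 := by field_simp
  rcases isEmpty_or_nonempty A with hA | hA
  · refine Eventually.of_forall fun N P Q hP _ => ?_
    have := hP.isProb
    obtain ⟨x₀⟩ : Nonempty (ℤ → A) := nonempty_of_isProbabilityMeasure P
    exact (hA.false (x₀ 0)).elim
  have hcard : 1 ≤ Fintype.card A := Fintype.card_pos
  obtain ⟨C, hC0, hC⟩ := exists_concentration (A := A) k₀ hβ hκ0 (show 0 < η / 3 by positivity)
  have hc1 : 0 < 1 / (C * (C₁ + 1)) := by positivity
  have hc2 : 0 < κ * (η / 3) / (β * C₁ * K) := by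
    have : (0 : ℝ) < K := by exact_mod_cast hK
    positivity
  have hc3 : 0 < 1 / C₁ ^ 2 := by positivity
  filter_upwards [eventually_missing_words_le (Fintype.card A) k₀ hcard hC₁0 hβ hκ0 hκ1
    (show 0 < η / 3 by positivity), eventually_log_rpow_le 1 one_pos hc1,
    eventually_log_rpow_le 1 hκ0 hc2, eventually_log_rpow_le 2 one_pos hc3,
    eventually_log_ge k₀, eventually_log_ge 1, eventually_log_ge (4 / ε), eventually_ge_atTop 1]
    with N hmiss hN1 hN2 hN3 hk hl1 hlε hN P Q hP hQ
  have := hP.isProb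
  have := hQ.isProb
  have hK' : (0 : ℝ) < K := by exact_mod_cast hK
  have hN0 : (0 : ℝ) < N := by exact_mod_cast hN
  rw [Real.rpow_one, Real.rpow_one] at hN1
  rw [Real.rpow_one] at hN2
  rw [Real.rpow_one, Real.rpow_two] at hN3
  set l := Real.log N with hl
  have hl0 : 0 < l := by linarith
  set L := Lmax R ε₀ N with hLdef
  have hL : (L : ℝ) ≤ C₁ * l := Lmax_le hR hN
  obtain ⟨M, hM, hmissM⟩ := hmiss L hL
  set θ : ℝ := (N : ℝ) ^ (-1 - κ) with hθ
  set θ' : ℝ := (N : ℝ) ^ (-1 + κ) with hθ'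
  have hN1' : (1 : ℝ) ≤ N := by exact_mod_cast hN
  have hinv : (N : ℝ) ^ (-1 : ℝ) = 1 / N := by rw [Real.rpow_neg_one, one_div]
  have hθ0 : 0 < θ := by positivity
  have hθ1 : θ ≤ 1 / N := by
    rw [← hinv]; exact Real.rpow_le_rpow_of_exponent_le hN1' (by linarith)
  have hθ'1 : 1 / N ≤ θ' := by
    rw [← hinv]; exact Real.rpow_le_rpow_of_exponent_le hN1' (by linarith)
  have hθ'2 : θ' ≤ 1 := Real.rpow_le_one_of_one_le_of_nonpos hN1' (by linarith)
  have hlogq : Real.log (θ' / θ) = 2 * κ * l := by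
    rw [hθ, hθ', ← Real.rpow_sub hN0, Real.log_rpow hN0]; ring
  have ht : Real.log (θ' / θ) / (-Real.log (1 - δ)) + 1 + κ * L + (L : ℝ) ^ 2 / N
      + κ * (C₁ * l) ≤ ε * l := by
    have e1 : Real.log (θ' / θ) / (-Real.log (1 - δ)) = 2 * κ * l * C₂ := by
      rw [hlogq, hC₂, mul_one_div]
    have e2 : (L : ℝ) ^ 2 / N ≤ 1 := by
      rw [div_le_one hN0]
      calc (L : ℝ) ^ 2 ≤ (C₁ * l) ^ 2 := by gcongr
        _ = C₁ ^ 2 * l ^ 2 := by ring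
        _ ≤ C₁ ^ 2 * (1 / C₁ ^ 2 * N) := by gcongr
        _ = N := by field_simp
    have e3 : κ * L ≤ κ * (C₁ * l) := by gcongr
    have e4 : 2 ≤ ε / 2 * l := by
      rw [div_le_iff₀ hε] at hlε; linarith
    have e5 := mul_le_mul_of_nonneg_right hκε hl0.le
    rw [e1]
    linarith
  have hrare : β * (L * (K * (N * θ))) / κ ≤ η / 3 := by
    have e1 : N * θ = (N ^ κ : ℝ)⁻¹ := by
      rw [hθ, sub_eq_add_neg, Real.rpow_add hN0, hinv, Real.rpow_neg hN0.le]
      field_simp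
    have hNκ : 0 < (N : ℝ) ^ κ := by positivity
    rw [e1, div_le_iff₀ hκ0]
    calc β * (L * (K * ((N : ℝ) ^ κ)⁻¹))
        ≤ β * (C₁ * (κ * (η / 3) / (β * C₁ * K) * N ^ κ) * (K * ((N : ℝ) ^ κ)⁻¹)) := by
          have : (L : ℝ) ≤ C₁ * (κ * (η / 3) / (β * C₁ * K) * N ^ κ) := hL.trans (by gcongr)
          gcongr
      _ = η / 3 * κ := by field_simp
  have hconc : ∀ P' : Measure (ℤ → A), P.real {x | κ * (C₁ * l) ≤ |(1 / (N : ℝ)) *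
      ∑ i ∈ Finset.range N, (wordLength R ε₀ N P' (shiftBy ((K * (N + k₀) : ℕ) + i) x) : ℝ) -
        meanLength R ε₀ N P P'|} ≤ η / 3 := fun P' => by
    refine hC δ P hP L N (C₁ * l) (fun x => (wordLength R ε₀ N P' x : ℝ)) (by positivity)
      ?_ ?_ hN ?_ _
    · exact fun x y h => congrArg _ (dependsOn_thresholdLength L (1 / (N : ℝ)) P' h)
    · refine fun x => ⟨by positivity, le_trans ?_ hL⟩
      have : thresholdLength L (1 / (N : ℝ)) P' x ≤ L := cappedLength_le
      exact_mod_cast this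
    · calc C * (L + k₀) ≤ C * ((C₁ + 1) * (1 / (C * (C₁ + 1)) * N)) := by
            have : (L : ℝ) + k₀ ≤ (C₁ + 1) * l := by linarith
            have h' : (C₁ + 1) * l ≤ (C₁ + 1) * (1 / (C * (C₁ + 1)) * N) := by gcongr
            gcongr
            exact this.trans h'
        _ = N := by field_simp
  have hpos : 0 ≤ (L : ℝ) * (K * (N * θ)) := by positivity
  constructor
  · have h := measureReal_meanMatchLength_le (μ := P.prod Q) (X := Prod.fst) (Y := Prod.snd)
      measurePreserving_fst measurePreserving_snd hQ hβ hδ₀ hδ₁ hK hN R ε₀ hθ0 hθ1 hθ'1 hθ'2 hκ0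
      (fun i => (hQ.measureReal_prod_rareMatch_le (K := K) (N := N) L hθ0.le _).trans
        (le_mul_of_one_le_left hpos hβ)) hM (hconc Q) ht
    exact h.trans (by linarith)
  · have h := measureReal_meanMatchLength_le (μ := P) (X := id) (Y := id)
      (MeasurePreserving.id P) (MeasurePreserving.id P) hP hβ hδ₀ hδ₁ hK hN R ε₀ hθ0 hθ1 hθ'1 hθ'2
      hκ0 (fun i => hP.measureReal_self_rareMatch_le (K := K) (N := N) (by linarith) L hθ0.le i)
      hM (hconc P) ht
    exact h.trans (by linarith)

lemma RatioMixing.le_meanLength {k₀ : ℕ} {β δ : ℝ} {P Q : Measure (ℤ → A)}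
    [IsProbabilityMeasure P] (hQ : RatioMixing k₀ β δ Q) (hδ₀ : 0 < δ) (hδ₁ : δ < 1) {N : ℕ}
    (hN : 0 < N) (R ε₀ : ℝ) :
    min (Lmax R ε₀ N : ℝ) (Real.log N / (-Real.log δ)) ≤ meanLength R ε₀ N P Q := by
  have hint : Integrable (fun x => (wordLength R ε₀ N Q x : ℝ)) P :=
    integrable_of_dependsOn (Set.finite_Icc 1 (Lmax R ε₀ N : ℤ)) fun x y h =>
      congrArg _ (dependsOn_thresholdLength (Lmax R ε₀ N) (1 / (N : ℝ)) Q h)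
  calc _ = ∫ _x, min (Lmax R ε₀ N : ℝ) (Real.log N / (-Real.log δ)) ∂P := by simp
    _ ≤ _ := integral_mono (integrable_const _) hint fun x =>
      hQ.min_le_thresholdLength hδ₀ hδ₁ hN (Lmax R ε₀ N) x

lemma abs_div_sub_div_le {t a b c e : ℝ} (ht : 0 ≤ t) (hc : 0 < c) (hb : c ≤ b)
    (hab : |a - b| ≤ e) (he : e ≤ c / 2) : |t / a - t / b| ≤ 2 * t * e / c ^ 2 := by
  have ha : c / 2 ≤ a := by
    have := (abs_le.1 hab).1
    linarith
  have ha0 : 0 < a := by linarith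
  have hb0 : 0 < b := by linarith
  have he0 : 0 ≤ e := (abs_nonneg _).trans hab
  have e1 : t / a - t / b = t * (b - a) / (a * b) := by field_simp
  rw [e1, abs_div, abs_mul, abs_of_nonneg ht, abs_of_pos (mul_pos ha0 hb0), abs_sub_comm]
  calc t * |a - b| / (a * b) ≤ t * e / (c / 2 * c) := by gcongr
    _ = _ := by field_simp

/-- Uniform convergence of the statistic `d_{VL,N}` to the divergence `D_{VL,N}` over all sources
with a given mixing constant. -/
theorem eventually_measureReal_dVL_sub_DVL_le (k₀ K : ℕ) (hK : 1 ≤ K) {δ R ε₀ β : ℝ}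
    (hδ₀ : 0 < δ) (hδ₁ : δ < 1) (hR : 0 < R + ε₀) (hβ : 1 ≤ β) {ε η : ℝ} (hε : 0 < ε)
    (hη : 0 < η) :
    ∀ᶠ N : ℕ in atTop, ∀ P Q : Measure (ℤ → A), RatioMixing k₀ β δ P → RatioMixing k₀ β δ Q →
      (P.prod Q).real {ω | ε ≤ |dVL R ε₀ K k₀ N (segment (seqLength K k₀ N) ω.1)
        (segment (seqLength K k₀ N) ω.2) - DVL R ε₀ N P Q|} ≤ η := by
  have hlog2 : 0 < Real.log 2 := Real.log_pos one_lt_two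
  have hlogδ : 0 < -Real.log δ := by
    have := Real.log_neg hδ₀ hδ₁
    linarith
  set c := min (1 / (2 * ((R + ε₀) * Real.log 2))) (1 / (-Real.log δ)) with hc
  have hc0 : 0 < c := lt_min (by positivity) (by positivity)
  set e := min (c / 2) (ε * c ^ 2 * Real.log 2 / 8) with he
  have he0 : 0 < e := lt_min (by positivity) (by positivity)
  filter_upwards [exists_meanMatchLength_close (A := A) k₀ K hK hδ₀ hδ₁ hR hβ he0
    (show 0 < η / 2 by positivity), eventually_le_Lmax hR, eventually_log_ge 1,
    eventually_ge_atTop 1] with N hclose hLmax hl1 hN P Q hP hQ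
  have := hP.isProb
  have := hQ.isProb
  obtain ⟨h1, h2⟩ := hclose P Q hP hQ
  set l := Real.log N with hl
  have hl0 : 0 < l := by linarith
  have hlow : ∀ Q', RatioMixing k₀ β δ Q' → c * l ≤ meanLength R ε₀ N P Q' := fun Q' hQ' => by
    refine le_trans (le_min ?_ ?_) (hQ'.le_meanLength hδ₀ hδ₁ hN R ε₀)
    · refine le_trans ?_ hLmax
      gcongr
      exact min_le_left _ _
    · rw [← one_div_mul_eq_div]
      gcongr
      exact min_le_right _ _
  have hdist : ∀ a b, c * l ≤ b → |a - b| < e * l →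
      |Real.logb 2 N / a - Real.logb 2 N / b| ≤ ε / 4 := by
    intro a b hb hab
    have ht : 0 ≤ Real.logb 2 N := by rw [Real.logb]; positivity
    have hec : e * l ≤ c * l / 2 := by
      calc e * l ≤ c / 2 * l := by gcongr; exact min_le_left _ _
        _ = _ := by ring
    refine (abs_div_sub_div_le ht (by positivity) hb hab.le hec).trans ?_
    have he' : e ≤ ε * c ^ 2 * Real.log 2 / 8 := min_le_right _ _
    calc 2 * Real.logb 2 N * (e * l) / (c * l) ^ 2 = 2 * e / (Real.log 2 * c ^ 2) := by
          rw [Real.logb, ← hl]; field_simp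
      _ ≤ 2 * (ε * c ^ 2 * Real.log 2 / 8) / (Real.log 2 * c ^ 2) := by gcongr
      _ = ε / 4 := by field_simp; norm_num
  set E₁ : Set ((ℤ → A) × (ℤ → A)) := {ω | e * l ≤ |meanMatchLength R ε₀ N
        (trainingBlocks K k₀ N (segment _ ω.2)) (suffix K k₀ N (segment _ ω.1)) -
          meanLength R ε₀ N P Q|} with hE₁
  set E₂ : Set (ℤ → A) := {x | e * l ≤ |meanMatchLength R ε₀ N
        (trainingBlocks K k₀ N (segment _ x)) (suffix K k₀ N (segment _ x)) -
          meanLength R ε₀ N P P|} with hE₂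
  have hsub : {ω : (ℤ → A) × (ℤ → A) | ε ≤ |dVL R ε₀ K k₀ N (segment (seqLength K k₀ N) ω.1)
      (segment (seqLength K k₀ N) ω.2) - DVL R ε₀ N P Q|} ⊆ E₁ ∪ Prod.fst ⁻¹' E₂ := by
    intro ω hω
    by_contra hcon
    simp only [Set.mem_union, not_or] at hcon
    have d1 := hdist _ _ (hlow Q hQ) (not_le.1 hcon.1)
    have d2 := hdist _ _ (hlow P hP) (not_le.1 hcon.2)
    have hω' : ε ≤ |dVL R ε₀ K k₀ N (segment (seqLength K k₀ N) ω.1)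
      (segment (seqLength K k₀ N) ω.2) - DVL R ε₀ N P Q| := hω
    rw [dVL, DVL] at hω'
    rw [sub_sub_sub_comm] at hω'
    have := abs_sub (Real.logb 2 N / meanMatchLength R ε₀ N
        (trainingBlocks K k₀ N (segment _ ω.2)) (suffix K k₀ N (segment _ ω.1)) -
        Real.logb 2 N / meanLength R ε₀ N P Q) (Real.logb 2 N / meanMatchLength R ε₀ N
        (trainingBlocks K k₀ N (segment _ ω.1)) (suffix K k₀ N (segment _ ω.1)) -
        Real.logb 2 N / meanLength R ε₀ N P P)
    linarith
  calc _ ≤ (P.prod Q).real (E₁ ∪ Prod.fst ⁻¹' E₂) := measureReal_mono hsub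
    _ ≤ (P.prod Q).real E₁ + (P.prod Q).real (Prod.fst ⁻¹' E₂) := measureReal_union_le _ _
    _ ≤ η / 2 + η / 2 := by
      gcongr
      exact (measureReal_preimage_le measurePreserving_fst _).trans h2
    _ = η := by ring

end Uniform

/-! ### The classification error -/

section Classification

variable {A : Type*} [MeasurableSpace A] {R ε₀ : ℝ} {N : ℕ}

/-- The divergence vanishes if the marginals of order `N` agree, because it involves words of length
less than `L_{max,N} ≤ N` only. -/
lemma DVL_eq_zero [Fintype A] [MeasurableSingletonClass A] {P Q : Measure (ℤ → A)}
    (hL : Lmax R ε₀ N ≤ N) (h : P.map (segment N) = Q.map (segment N)) : DVL R ε₀ N P Q = 0 := by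
  have hm : Measurable (segment N : (ℤ → A) → Fin N → A) :=
    measurable_pi_lambda _ fun i => measurable_pi_apply ((i : ℤ) + 1)
  have hw : ∀ x, ∀ n ≤ N, wordProb Q x n = wordProb P x n := by
    intro x n hn
    have e : cylinder x n = segment N ⁻¹' {u | ∀ i : Fin N, (i : ℕ) < n → u i = x (i + 1)} := by
      ext y
      constructor
      · intro hy i hi
        exact hy (i + 1) (by omega) (by omega)
      · intro hy i h1 h2
        have := hy ⟨(i - 1).toNat, by omega⟩ (by simp only; omega)
        have hi : (((i - 1).toNat : ℕ) : ℤ) + 1 = i := by omega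
        simpa only [segment, hi] using this
    have hms : MeasurableSet {u : Fin N → A | ∀ i : Fin N, (i : ℕ) < n → u i = x (i + 1)} :=
      (Set.toFinite _).measurableSet
    rw [wordProb_eq, wordProb_eq, e, ← map_measureReal_apply hm hms, ← map_measureReal_apply hm hms,
      h]
  have : meanLength R ε₀ N P Q = meanLength R ε₀ N P P := by
    unfold meanLength
    congr 1
    funext x
    rw [wordLength_eq, wordLength_eq]
    exact congrArg _ (cappedLength_congr fun n hn => by rw [hw x n (hn.le.trans hL)])
  rw [DVL, this, sub_self]

/-- A classification error forces the statistic `d_{VL,N}` to deviate from the divergence by at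
least `Δ / 2`. -/
lemma errorProb_le [Fintype A] [MeasurableSingletonClass A] {P Q : Measure (ℤ → A)} (K k₀ : ℕ)
    (hL : Lmax R ε₀ N ≤ N) {Δ₀ Δ : ℝ} (hΔ : Δ₀ ≤ Δ) :
    errorProb R ε₀ N (seqLength K k₀ N) (fVL A R ε₀ K k₀ N Δ) Δ P Q ≤
      (P.prod Q) {ω | Δ₀ / 2 ≤ |dVL R ε₀ K k₀ N (segment (seqLength K k₀ N) ω.1)
        (segment (seqLength K k₀ N) ω.2) - DVL R ε₀ N P Q|} := by
  refine measure_mono ?_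
  rintro ω (⟨hf, hPQ⟩ | ⟨hD, hf⟩)
  · have h : Δ / 2 ≤ dVL R ε₀ K k₀ N (segment (seqLength K k₀ N) ω.1)
        (segment (seqLength K k₀ N) ω.2) := by
      by_contra hcon
      rw [fVL, if_neg hcon] at hf
      exact absurd hf (by decide)
    simp only [Set.mem_ofPred_eq, DVL_eq_zero hL hPQ, sub_zero]
    exact le_trans (by linarith) (le_abs_self _)
  · have h : ¬ Δ / 2 ≤ dVL R ε₀ K k₀ N (segment (seqLength K k₀ N) ω.1)
        (segment (seqLength K k₀ N) ω.2) := by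
      intro hcon
      rw [fVL, if_pos hcon] at hf
      exact absurd hf (by decide)
    simp only [Set.mem_ofPred_eq]
    rw [abs_sub_comm]
    exact le_trans (by linarith [not_le.1 h]) (le_abs_self _)

variable [Fintype A] [MeasurableSingletonClass A]

/-- The deviation is small uniformly over all classes whose mixing constant is at most `β'`. -/
lemma eventually_deviation_le (k₀ K : ℕ) (hK : 1 ≤ K) {δ R ε₀ β' : ℝ} (hδ₀ : 0 < δ) (hδ₁ : δ < 1)
    (hR : 0 < R + ε₀) (hβ' : 1 ≤ β') {ε : ℝ} (hε : 0 < ε) {η : ℝ≥0∞} (hη : 0 < η) :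
    ∀ᶠ N : ℕ in atTop, ∀ (α β : ℝ) (ℓ n₀ : ℕ), 0 < β → β ≤ β' →
      deviation R ε₀ K k₀ N ε (vanishingMemoryClass A k₀ α β δ R ℓ n₀) ≤ η := by
  obtain ⟨η', hη', hη'η⟩ : ∃ η' : ℝ, 0 < η' ∧ ENNReal.ofReal η' ≤ η := by
    rcases eq_or_ne η ∞ with rfl | hne
    · exact ⟨1, one_pos, le_top⟩
    · exact ⟨η.toReal, ENNReal.toReal_pos hη.ne' hne, ENNReal.ofReal_toReal_le⟩
  filter_upwards [eventually_measureReal_dVL_sub_DVL_le (A := A) k₀ K hK hδ₀ hδ₁ hR hβ' hε hη']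
    with N hN α β ℓ n₀ hβ hββ'
  refine iSup₂_le fun P hP => iSup₂_le fun Q hQ => ?_
  have hP' := IsVanishingMemory.ratioMixing hP hβ hββ'
  have hQ' := IsVanishingMemory.ratioMixing hQ hβ hββ'
  have := hP'.isProb
  have := hQ'.isProb
  refine le_trans ?_ hη'η
  rw [← ofReal_measureReal]
  exact ENNReal.ofReal_le_ofReal (hN P Q hP' hQ')

lemma classError_le_deviation (K k₀ : ℕ) (hL : Lmax R ε₀ N ≤ N) {Δ₀ Δ : ℝ} (hΔ : Δ₀ ≤ Δ)
    (M : Set (Measure (ℤ → A))) :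
    classError R ε₀ N (seqLength K k₀ N) (fVL A R ε₀ K k₀ N Δ) Δ M ≤
      deviation R ε₀ K k₀ N (Δ₀ / 2) M :=
  iSup₂_mono fun _ _ => iSup₂_mono fun _ _ => errorProb_le K k₀ hL hΔ

end Classification

end VLClassification

theorem mainTheorem2 {A : Type*} [Fintype A] [MeasurableSpace A] [MeasurableSingletonClass A]
    (k₀ K : ℕ) (hK : 1 ≤ K) (δ R ε₀ : ℝ) (hδ₀ : 0 < δ) (hδ₁ : δ < 1) (hR : 0 < R) (hε₀ : 0 < ε₀) :
    (∀ (α β : ℝ) (ℓ n₀ : ℕ), 0 < α → α < 1 → 1 < β → 1 ≤ ℓ → ℓ ≤ n₀ →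
      (∀ ε : ℝ, 0 < ε →
        Tendsto (fun N : ℕ => VLClassification.deviation R ε₀ K k₀ N ε
          (VLClassification.vanishingMemoryClass A k₀ α β δ R ℓ n₀)) atTop (𝓝 0)) ∧
      (∀ Δ : ℝ, 0 < Δ →
        Tendsto (fun N : ℕ => VLClassification.classError R ε₀ N
          (VLClassification.seqLength K k₀ N) (VLClassification.fVL A R ε₀ K k₀ N Δ) Δ
          (VLClassification.vanishingMemoryClass A k₀ α β δ R ℓ n₀)) atTop (𝓝 0))) ∧
    (∀ Δ₀ : ℝ, 0 < Δ₀ → ∃ β₀ : ℝ, 1 < β₀ ∧ ∃ α₀ : ℝ, 0 < α₀ ∧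
      ∀ η : ℝ≥0∞, 0 < η → ∃ ℓ₀ : ℕ, ∀ (ℓ n₀ : ℕ) (α β : ℝ),
        1 ≤ ℓ → ℓ₀ ≤ ℓ → ℓ ≤ n₀ → 0 < α → α < 1 → α ≤ α₀ → 1 < β → β ≤ β₀ →
        ∀ N : ℕ, (2 : ℝ) ^ (R * (ℓ : ℝ)) * (2 : ℝ) ^ (ε₀ * (ℓ : ℝ)) ≤
            (VLClassification.seqLength K k₀ N : ℝ) →
          ∀ Δ : ℝ, Δ₀ ≤ Δ →
            VLClassification.classError R ε₀ N
              (VLClassification.seqLength K k₀ N) (VLClassification.fVL A R ε₀ K k₀ N Δ) Δ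
              (VLClassification.vanishingMemoryClass A k₀ α β δ R ℓ n₀) ≤ η) := by
  have hRε : 0 < R + ε₀ := by positivity
  refine ⟨fun α β ℓ n₀ _ _ hβ _ _ => ⟨fun ε hε => ?_, fun Δ hΔ => ?_⟩, fun Δ₀ hΔ₀ => ?_⟩
  · refine ENNReal.tendsto_nhds_zero.2 fun η hη => ?_
    filter_upwards [VLClassification.eventually_deviation_le (A := A) k₀ K hK hδ₀ hδ₁ hRε hβ.le hε
      hη] with N hN
    exact hN α β ℓ n₀ (by linarith) le_rfl
  · refine ENNReal.tendsto_nhds_zero.2 fun η hη => ?_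
    filter_upwards [VLClassification.eventually_deviation_le (A := A) k₀ K hK hδ₀ hδ₁ hRε hβ.le
      (half_pos hΔ) hη, VLClassification.eventually_Lmax_le_self hRε] with N hN hL
    exact (VLClassification.classError_le_deviation K k₀ hL le_rfl _).trans
      (hN α β ℓ n₀ (by linarith) le_rfl)
  -- The error vanishes uniformly over every bounded range of mixing constants.
  · refine ⟨2, one_lt_two, 1, one_pos, fun η hη => ?_⟩
    obtain ⟨N₁, hN₁⟩ := eventually_atTop.1
      ((VLClassification.eventually_deviation_le (A := A) k₀ K hK hδ₀ hδ₁ hRε one_le_two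
        (half_pos hΔ₀) hη).and (VLClassification.eventually_Lmax_le_self hRε))
    have hlim : Tendsto (fun ℓ : ℕ => (2 : ℝ) ^ ((R + ε₀) * (ℓ : ℝ))) atTop atTop :=
      (tendsto_rpow_atTop_of_base_gt_one 2 one_lt_two).comp
        (tendsto_natCast_atTop_atTop.const_mul_atTop hRε)
    obtain ⟨ℓ₀, hℓ₀⟩ := eventually_atTop.1
      (hlim.eventually_gt_atTop (VLClassification.seqLength K k₀ N₁ : ℝ))
    refine ⟨ℓ₀, fun ℓ n₀ α β _ hℓ _ _ _ _ hβ hβ₀ N hN Δ hΔ => ?_⟩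
    have hNN₁ : N₁ ≤ N := by
      by_contra hcon
      have h1 : VLClassification.seqLength K k₀ N ≤ VLClassification.seqLength K k₀ N₁ := by
        unfold VLClassification.seqLength
        gcongr <;> omega
      have h2 : (VLClassification.seqLength K k₀ N : ℝ) ≤ VLClassification.seqLength K k₀ N₁ := by
        exact_mod_cast h1
      have h3 := hℓ₀ ℓ hℓ
      rw [← Real.rpow_add two_pos, ← add_mul] at hN
      linarith
    obtain ⟨hdev, hL⟩ := hN₁ N hNN₁
    exact (VLClassification.classError_le_deviation K k₀ hL hΔ _).trans
      (hdev α β ℓ n₀ (by linarith) hβ₀)
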